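/- Setting. Let $\mathcal Y$ (actions) and $\mathcal O$ (observations) be finite sets, $\mathcal Y\neq\emptyset$, and let $\mathcal R\subset[0,r_{\max}]$ be a finite set of rewards. In cycle $k$ the agent takes an action $y_k\in\mathcal Y$ and receives $x_k=(r_k,o_k)\in\mathcal R\times\mathcal O$; put $z_k=(y_k,x_k)$. A (deterministic) policy $p$ maps each finite history $z_{<k}=z_1\dots z_{k-1}$ to an action; an environment $\nu$ gives for each history $z_{<k}$ and action $y_k$ a probability distribution $\nu(\cdot\mid z_{<k}y_k)$ of $x_k$. Together they generate a random sequence $z_1z_2\dots$ with rewards $r_i^{p\nu}$. Write $r_{k..n}=r_k+\dots+r_n$, $\overline V(\nu,p)=\limsup_m\frac1m r^{p\nu}_{1..m}$, $\underline V(\nu,p)=\liminf_m\frac1m r^{p\nu}_{1..m}$ (random variables). A history $z_{<k}$ is called possible under $\nu$ if $\nu(x_{<k}\mid y_{<k}):=\prod_{i<k}\nu(x_i\mid z_{<i}y_i)>0$; for such a history, $\mathbf P(\,\cdot\mid z_{<k})$ is the probability for $\nu$ and the policy $p$ with its first $k-1$ actions replaced by $y_{<k}$, conditional on the event that the interaction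 starts with $z_{<k}$. The environment $\nu$ is strongly explorable (respectively strongly upper explorable) if for every possible history $z_{<k}$ there are a policy $q$ and a constant $v$ with $\overline V(\nu,q)=\underline V(\nu,q)=v$ (respectively $\overline V(\nu,q)=v$) $\mathbf P(\cdot\mid z_{<k})$-a.s., and $\overline V(\nu,p)\le v$ $\mathbf P(\cdot\mid z_{<k})$-a.s. for every policy $p$. The constant $v$ is denoted $V^*_\nu(z_{<k})$ (respectively $\overline V^*_\nu(z_{<k})$), and $$W^*_\nu=\inf_{z_{<k}\text{ possible}}V^*_\nu(z_{<k}),\qquad \overline W^*_\nu=\inf_{z_{<k}\text{ possible}}\overline V^*_\nu(z_{<k}),$$ where the infimum is over all $k\ge1$ and all possible histories. A strongly explorable environment $\nu$ is worst-case value-stable if there exist numbers $r^\nu_i\in[0,r_{\max}]$ and functions $d_\nu(k,\varepsilon)$, $\varphi_\nu(n,\varepsilon)$ such that $\frac1n r^\nu_{1..n}\to W^*_\nu$, for every fixed $\varepsilon>0$ both $d_\nu(k,\varepsilon)=o(k)$ and $\sum_{n\ge1}\varphi_\nu(n,\varepsilon)<\infty$, and for every $k\geq 1$ and every possible history $z_{<k}$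 there is a policy $p$ such that for all $\varepsilon>0$ and $n\ge1$ $$\mathbf P\big(r^\nu_{k..k+n}-r^{p\nu}_{k..k+n}>d_\nu(k,\varepsilon)+n\varepsilon\mid z_{<k}\big)\le\varphi_\nu(n,\varepsilon).$$ Theorem. (i) For every countable set $\mathcal C$ of worst-case value-stable environments there is a policy $p$ such that for every $\nu\in\mathcal C$, $\liminf_m\frac1m r^{p\nu}_{1..m}\ge W^*_\nu$ with probability 1. (ii) For every countable set $\mathcal C$ of strongly upper explorable environments there is a policy $p$ such that for every $\nu\in\mathcal C$, $\limsup_m\frac1m r^{p\nu}_{1..m}\ge\overline W^*_\nu$ with probability 1. -/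

import Mathlib

open MeasureTheory ProbabilityTheory Filter Topology

namespace Reactive

/-- A percept `x = (r, o)`: a reward from the finite set `R ⊆ ℝ` and an observation. -/
structure Percept (R : Finset ℝ) (O : Type*) where
  reward : R
  observation : O

/-- One interaction cycle `z = (y, x)`: an action and the percept that answers it. -/
structure Cycle (Y : Type*) (R : Finset ℝ) (O : Type*) where
  action : Y
  percept : Percept R O

instance (Y : Type*) (R : Finset ℝ) (O : Type*) : MeasurableSpace (Cycle Y R O) := ⊤

instance (Y : Type*) (R : Finset ℝ) (O : Type*) : DiscreteMeasurableSpace (Cycle Y R O) :=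
  ⟨fun _ => trivial⟩

instance (R : Finset ℝ) (O : Type*) [Finite O] : Finite (Percept R O) :=
  Finite.of_injective (fun x : Percept R O => (x.reward, x.observation)) (by
    rintro ⟨a, b⟩ ⟨c, d⟩ h
    simpa using h)

instance (Y : Type*) (R : Finset ℝ) (O : Type*) [Finite Y] [Finite O] : Finite (Cycle Y R O) :=
  Finite.of_injective (fun z : Cycle Y R O => (z.action, z.percept)) (by
    rintro ⟨a, b⟩ ⟨c, d⟩ h
    simpa using h)

/-- The numerical reward received in a cycle. -/
def Cycle.rewardValue {Y : Type*} {R : Finset ℝ} {O : Type*} (z : Cycle Y R O) : ℝ :=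
  (z.percept.reward : ℝ)

/-- A finite history `z_1 z_2 … z_n`, in chronological order. -/
abbrev History (Y : Type*) (R : Finset ℝ) (O : Type*) := List (Cycle Y R O)

/-- A (deterministic) policy: it chooses the next action as a function of the history. -/
abbrev Policy (Y : Type*) (R : Finset ℝ) (O : Type*) := History Y R O → Y

/-- An environment: `ν h y x` is the probability `ν(x | h y)` of the percept `x` when the action
`y` is taken after the history `h`. -/
abbrev Environment (Y : Type*) (R : Finset ℝ) (O : Type*) := History Y R O → Y → PMF (Percept R O)

section

variable {Y : Type*} {R : Finset ℝ} {O : Type*}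

/-- The probability `ν(x_1 … x_n | y_1 … y_n) = ∏ ν(x_i | z_1 … z_{i-1} y_i)` of the percepts of a
history `h = z_1 … z_n` given its actions. -/
noncomputable def Environment.historyProb (ν : Environment Y R O) (h : History Y R O) : ENNReal :=
  ∏ i : Fin h.length, ν (h.take i) (h.get i).action (h.get i).percept

/-- The history formed by the first `n` cycles of an infinite sequence. (Cycles of an infinite
sequence `ω` are indexed from `0`: cycle number `i + 1` is `ω i`.) -/
def firstCycles (ω : ℕ → Cycle Y R O) (n : ℕ) : History Y R O :=
  List.ofFn fun i : Fin n => ω i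

/-- The law of the next cycle after the history `h`. -/
noncomputable def cycleLaw (ν : Environment Y R O) (p : Policy Y R O) (h : History Y R O) :
    Measure (Cycle Y R O) :=
  ((ν h (p h)).map (Cycle.mk (p h))).toMeasure

instance (ν : Environment Y R O) (p : Policy Y R O) (h : History Y R O) :
    IsProbabilityMeasure (cycleLaw ν p h) := by
  unfold cycleLaw
  infer_instance

/-- The law of the next cycle, as a Markov kernel of the first `n + 1` cycles. -/
noncomputable def cycleKernel [Finite Y] [Finite O] (ν : Environment Y R O) (p : Policy Y R O)
    (n : ℕ) : Kernel ((i : Finset.Iic n) → (fun _ : ℕ => Cycle Y R O) i) (Cycle Y R O) where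
  toFun z := cycleLaw ν p
    (List.ofFn fun i : Fin (n + 1) => z ⟨i, Finset.mem_Iic.2 (Nat.lt_succ_iff.1 i.2)⟩)
  measurable' := measurable_of_finite _

instance [Finite Y] [Finite O] (ν : Environment Y R O) (p : Policy Y R O) (n : ℕ) :
    IsMarkovKernel (cycleKernel ν p n) :=
  ⟨fun z => by
    change IsProbabilityMeasure (cycleLaw ν p _)
    infer_instance⟩

/-- The law of the infinite interaction sequence that policy `p` and environment `ν` generate. -/
noncomputable def law [Finite Y] [Finite O] (ν : Environment Y R O) (p : Policy Y R O) :
    Measure (ℕ → Cycle Y R O) :=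
  Kernel.trajMeasure (X := fun _ => Cycle Y R O) (cycleLaw ν p []) (cycleKernel ν p)

/-- The policy `p` with its first actions replaced by the actions of the history `h`. -/
def Policy.replace (p : Policy Y R O) (h : History Y R O) : Policy Y R O :=
  fun g => if hg : g.length < h.length then (h.get ⟨g.length, hg⟩).action else p g

/-- The conditional law `P(· | h)` given the history `h`: the first actions of `p` are
replaced by those of `h`, and one conditions on the event that the interaction starts with `h`. -/
noncomputable def condLaw [Finite Y] [Finite O] (ν : Environment Y R O) (p : Policy Y R O)
    (h : History Y R O) : Measure (ℕ → Cycle Y R O) :=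
  ProbabilityTheory.cond (law ν (p.replace h)) {ω | firstCycles ω h.length = h}

/-- The average reward `(r_1 + … + r_m) / m` of the first `m` cycles. -/
noncomputable def averageReward (ω : ℕ → Cycle Y R O) (m : ℕ) : ℝ :=
  (∑ i ∈ Finset.range m, (ω i).rewardValue) / m

/-- Upper limiting average reward. -/
noncomputable def upperAverage (ω : ℕ → Cycle Y R O) : ℝ :=
  limsup (averageReward ω) atTop

/-- Lower limiting average reward. -/
noncomputable def lowerAverage (ω : ℕ → Cycle Y R O) : ℝ :=
  liminf (averageReward ω) atTop

/-- `v` is the optimal average value `V^*_ν(h)` given the history `h`: some policy has the average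
value `v` conditionally on `h`, and no policy has a larger upper average value. -/
def Environment.IsOptimalValue [Finite Y] [Finite O] (ν : Environment Y R O) (h : History Y R O)
    (v : ℝ) : Prop :=
  (∃ q : Policy Y R O, ∀ᵐ ω ∂(condLaw ν q h), upperAverage ω = v ∧ lowerAverage ω = v) ∧
    ∀ p : Policy Y R O, ∀ᵐ ω ∂(condLaw ν p h), upperAverage ω ≤ v

/-- `v` is the upper optimal average value given the history `h`: some policy has the upper average
value `v` conditionally on `h`, and no policy has a larger upper average value. -/
def Environment.IsUpperOptimalValue [Finite Y] [Finite O] (ν : Environment Y R O)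
    (h : History Y R O) (v : ℝ) : Prop :=
  (∃ q : Policy Y R O, ∀ᵐ ω ∂(condLaw ν q h), upperAverage ω = v) ∧
    ∀ p : Policy Y R O, ∀ᵐ ω ∂(condLaw ν p h), upperAverage ω ≤ v

/-- Strongly explorable: after every history of positive probability there is an optimal policy. -/
def Environment.StronglyExplorable [Finite Y] [Finite O] (ν : Environment Y R O) : Prop :=
  ∀ h : History Y R O, 0 < ν.historyProb h → ∃ v, ν.IsOptimalValue h v

/-- Strongly upper explorable. -/
def Environment.StronglyUpperExplorable [Finite Y] [Finite O] (ν : Environment Y R O) : Prop :=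
  ∀ h : History Y R O, 0 < ν.historyProb h → ∃ v, ν.IsUpperOptimalValue h v

/-- The worst-case optimal value `W^*_ν`: the infimum of the optimal values over all histories of
positive probability. -/
noncomputable def Environment.worstCaseValue [Finite Y] [Finite O] (ν : Environment Y R O) : ℝ :=
  sInf {v | ∃ h : History Y R O, 0 < ν.historyProb h ∧ ν.IsOptimalValue h v}

/-- The worst-case upper optimal value: the infimum of the upper optimal values over all histories
of positive probability. -/
noncomputable def Environment.worstCaseUpperValue [Finite Y] [Finite O]
    (ν : Environment Y R O) : ℝ :=
  sInf {v | ∃ h : History Y R O, 0 < ν.historyProb h ∧ ν.IsUpperOptimalValue h v}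

/-- Worst-case value-stability, for rewards in `[0, rmax]`. The reference rewards are
`ρ 0, ρ 1, …` for the cycles number `1, 2, …`, so that, for a history `h` of length `k - 1`, the sum
over the cycles number `k, …, k + n` runs over the indices `h.length, …, h.length + n`. -/
def Environment.WorstCaseValueStable [Finite Y] [Finite O] (rmax : ℝ) (ν : Environment Y R O) :
    Prop :=
  ν.StronglyExplorable ∧
  ∃ (ρ : ℕ → ℝ) (d φ : ℕ → ℝ → ℝ),
    (∀ i, ρ i ∈ Set.Icc 0 rmax) ∧
    Tendsto (fun n : ℕ => (∑ i ∈ Finset.range n, ρ i) / n) atTop (𝓝 ν.worstCaseValue) ∧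
    (∀ ε > 0, (fun k : ℕ => d k ε) =o[atTop] fun k : ℕ => (k : ℝ)) ∧
    (∀ ε > 0, Summable fun n => φ n ε) ∧
    ∀ h : History Y R O, 0 < ν.historyProb h →
      ∃ p : Policy Y R O, ∀ ε > 0, ∀ n ≥ 1,
        (condLaw ν p h).real
          {ω | d (h.length + 1) ε + n * ε <
            ∑ i ∈ Finset.Icc h.length (h.length + n), ρ i -
              ∑ i ∈ Finset.Icc h.length (h.length + n), (ω i).rewardValue} ≤ φ n ε

end

end Reactive

/-! Both parts switch, at history-dependent times, between policies that are good for a single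
environment. The target is a worst case over possible histories, so nothing done before a switch
does lasting harm: if environment `j` is the true one, some policy still attains its target from the
current history. Each return to `j` fails with small probability; these probabilities are summable,
and Borel–Cantelli leaves finitely many failures. The common tool is `law_biUnion_le_of_condLaw_le`,
which turns bounds conditional on the history at a switch into a bound for the composite policy.

For upper averages it suffices to come close to the target infinitely often. Phase `a` serves one
environment, every environment gets infinitely many phases, and a phase lasts until, with
conditional probability at least `1 - 2⁻ᵃ`, the average has exceeded the target minus `1 / (a + 1)`
(`exists_deadline`). What happens in the other phases is irrelevant.

For lower averages all times count, including those spent on wrong environments. Time is cut into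
stages whose starting times at least double. In stage `s` the environments `0, …, s` are tried in
order of decreasing target, and the one on trial is rejected, for this stage, when the rewards fall
too far below its reference rewards. Summability of `φ` makes rejection of the true environment
unlikely (`eventually_condLaw_le`, `TrialSchedule.law_rejectionEvent_le`). While the true one is not
rejected, the one on trial has at least as large a target, and passing its tests guarantees rewards
near that target, whether or not it is the true one. A stage sees at most `s` rejections of other
environments, each at a negligible cost (`TrialSchedule.deficit_le`), and the doubling keeps the
accumulated error proportional to the elapsed time (`TrialSchedule.value_le_lowerAverage`). -/

namespace Reactive

/-! ### Cylinders of histories and their probabilities, one cycle at a time -/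

section Histories

variable {Y : Type*} {R : Finset ℝ} {O : Type*}

@[simp]
theorem length_firstCycles (ω : ℕ → Cycle Y R O) (n : ℕ) : (firstCycles ω n).length = n := by
  simp [firstCycles]

theorem firstCycles_zero (ω : ℕ → Cycle Y R O) : firstCycles ω 0 = [] := by
  simp [firstCycles]

theorem firstCycles_succ (ω : ℕ → Cycle Y R O) (n : ℕ) :
    firstCycles ω (n + 1) = firstCycles ω n ++ [ω n] := by
  unfold firstCycles
  rw [List.ofFn_succ_last]
  simp

theorem getElem_firstCycles (ω : ℕ → Cycle Y R O) {n i : ℕ} (hi : i < (firstCycles ω n).length) :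
    (firstCycles ω n)[i] = ω i := by
  simp [firstCycles]

theorem take_firstCycles (ω : ℕ → Cycle Y R O) {m n : ℕ} (h : m ≤ n) :
    (firstCycles ω n).take m = firstCycles ω m := by
  refine List.ext_getElem (by simp [h]) fun i h₁ h₂ => ?_
  rw [List.getElem_take, getElem_firstCycles, getElem_firstCycles]

theorem firstCycles_isPrefix (ω : ℕ → Cycle Y R O) {m n : ℕ} (h : m ≤ n) :
    firstCycles ω m <+: firstCycles ω n := by
  rw [← take_firstCycles ω h]
  exact List.take_prefix _ _

/-- The set of infinite sequences that start with the history `h`. -/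
def cylinder (h : History Y R O) : Set (ℕ → Cycle Y R O) :=
  {ω | firstCycles ω h.length = h}

theorem mem_cylinder {h : History Y R O} {ω : ℕ → Cycle Y R O} :
    ω ∈ cylinder h ↔ firstCycles ω h.length = h := Iff.rfl

theorem mem_cylinder_firstCycles (ω : ℕ → Cycle Y R O) (n : ℕ) :
    ω ∈ cylinder (firstCycles ω n) := by
  simp [mem_cylinder]

theorem cylinder_nil : cylinder ([] : History Y R O) = Set.univ := by
  ext ω
  simp [mem_cylinder, firstCycles_zero]

theorem mem_cylinder_iff_getElem {h : History Y R O} {ω : ℕ → Cycle Y R O} :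
    ω ∈ cylinder h ↔ ∀ (i : ℕ) (hi : i < h.length), ω i = h[i] := by
  rw [mem_cylinder]
  constructor
  · intro e i hi
    have := getElem_firstCycles ω (n := h.length) (i := i) (by simpa using hi)
    rw [← this]
    congr 1
  · intro e
    refine List.ext_getElem (by simp) fun i h₁ h₂ => ?_
    rw [getElem_firstCycles, e i h₂]

theorem cylinder_anti {g h : History Y R O} (hgh : h <+: g) : cylinder g ⊆ cylinder h := by
  intro ω hω
  rw [mem_cylinder] at *
  rw [← take_firstCycles ω hgh.length_le, hω, ← List.prefix_iff_eq_take.1 hgh]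

theorem isPrefix_of_mem_cylinder {g h : History Y R O} {ω : ℕ → Cycle Y R O}
    (hg : ω ∈ cylinder g) (hh : ω ∈ cylinder h) (hl : h.length ≤ g.length) : h <+: g := by
  rw [List.prefix_iff_eq_take]
  rw [mem_cylinder] at *
  conv_lhs => rw [← hh, ← take_firstCycles ω hl, hg]

theorem measurableSet_cylinder (h : History Y R O) : MeasurableSet (cylinder h) := by
  have : cylinder h = ⋂ i : Fin h.length, (fun ω : ℕ → Cycle Y R O => ω i) ⁻¹' {h[i]} := by
    ext ω
    simp only [mem_cylinder_iff_getElem, Set.mem_iInter, Set.mem_preimage, Set.mem_singleton_iff]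
    exact ⟨fun H i => H i i.2, fun H i hi => H ⟨i, hi⟩⟩
  rw [this]
  exact MeasurableSet.iInter fun i => measurable_pi_apply _ (MeasurableSet.singleton _)

variable [Finite Y] [Finite O]

theorem law_cylinder_singleton (ν : Environment Y R O) (p : Policy Y R O) (z : Cycle Y R O) :
    law ν p (cylinder [z]) = cycleLaw ν p [] {z} := by
  have hc : cylinder [z] = Preorder.frestrictLe (π := fun _ : ℕ => Cycle Y R O) 0 ⁻¹'
      {fun _ => z} := by
    ext ω
    simp only [mem_cylinder_iff_getElem, Set.mem_preimage, Set.mem_singleton_iff, funext_iff]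
    constructor
    · intro H i
      have hi : i.1 = 0 := by simpa using Finset.mem_Iic.1 i.2
      have := H 0 (by simp)
      simp [Preorder.frestrictLe_apply, hi, this]
    · intro H i hi
      have hi : i = 0 := by simpa using hi
      subst hi
      exact H ⟨0, by simp⟩
  have hm : MeasurableSet
      ({fun _ => z} : Set ((i : Finset.Iic 0) → (fun _ : ℕ => Cycle Y R O) i)) :=
    MeasurableSet.singleton _
  rw [hc, ← Measure.map_apply (by fun_prop) hm, law, Kernel.trajMeasure,
    Measure.map_comp _ _ (by fun_prop), Kernel.traj_map_frestrictLe, Kernel.partialTraj_self,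
    Measure.id_comp, Measure.map_apply (by fun_prop) hm]
  congr 1
  ext x
  simp only [Set.mem_preimage, Set.mem_singleton_iff]
  constructor
  · intro H
    simpa using congrFun H ⟨0, by simp⟩
  · rintro rfl
    funext i
    obtain ⟨i, hi⟩ := i
    have hi : i = 0 := by simpa using hi
    subst hi
    rfl

/-- This is the defining property of the trajectory measure. The empty history is separate because
the kernels start only after the first cycle, which is drawn from the initial law. -/
theorem law_cylinder_concat (ν : Environment Y R O) (p : Policy Y R O) (g : History Y R O)
    (z : Cycle Y R O) :
    law ν p (cylinder (g ++ [z])) = law ν p (cylinder g) * cycleLaw ν p g {z} := by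
  rcases hg : g.length with _ | a
  · have : g = [] := by simpa using hg
    subst this
    have : law ν p Set.univ = 1 := by unfold law; exact measure_univ
    rw [cylinder_nil, this, one_mul]
    exact law_cylinder_singleton ν p z
  · let x : (i : Finset.Iic a) → (fun _ : ℕ => Cycle Y R O) i := fun i =>
      g[i.1]'(by have := Finset.mem_Iic.1 i.2; omega)
    have hx : (List.ofFn fun i : Fin (a + 1) =>
        x ⟨i, Finset.mem_Iic.2 (Nat.lt_succ_iff.1 i.2)⟩) = g := by
      refine List.ext_getElem (by simp [hg]) fun i h₁ h₂ => ?_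
      rw [List.getElem_ofFn]
    have h₁ : cylinder g = Preorder.frestrictLe (π := fun _ : ℕ => Cycle Y R O) a ⁻¹' {x} := by
      ext ω
      simp only [mem_cylinder_iff_getElem, Set.mem_preimage, Set.mem_singleton_iff, funext_iff]
      constructor
      · intro H i
        exact H _ _
      · intro H i hi
        exact H ⟨i, Finset.mem_Iic.2 (by omega)⟩
    have h₂ : cylinder (g ++ [z]) = (fun ω : ℕ → Cycle Y R O =>
        (Preorder.frestrictLe (π := fun _ : ℕ => Cycle Y R O) a ω, ω (a + 1))) ⁻¹'
          ({x} ×ˢ {z}) := by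
      rw [Set.mk_preimage_prod, ← h₁]
      ext ω
      simp only [mem_cylinder_iff_getElem, Set.mem_inter_iff, Set.mem_preimage,
        Set.mem_singleton_iff]
      constructor
      · intro H
        refine ⟨fun i hi => ?_, ?_⟩
        · rw [H i (by simp; omega), List.getElem_append_left hi]
        · rw [H (a + 1) (by simp; omega)]
          simp [hg]
      · rintro ⟨H, H'⟩ i hi
        rw [List.length_append, List.length_singleton] at hi
        rcases Nat.lt_succ_iff_lt_or_eq.1 hi with hi | hi
        · rw [H i hi, List.getElem_append_left hi]
        · subst hi
          simp [hg, H']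
    have hm : MeasurableSet ({x} : Set ((i : Finset.Iic a) → (fun _ : ℕ => Cycle Y R O) i)) :=
      MeasurableSet.singleton _
    have hz : MeasurableSet ({z} : Set (Cycle Y R O)) := MeasurableSet.singleton _
    rw [h₁, h₂, ← Measure.map_apply (by fun_prop) (hm.prod hz), law,
      ← Kernel.map_frestrictLe_trajMeasure_compProd_eq_map_trajMeasure,
      Measure.compProd_apply_prod hm hz, lintegral_singleton, mul_comm,
      Measure.map_apply (by fun_prop) hm]
    congr 1
    change cycleLaw ν p _ {z} = _
    rw [hx]

instance (ν : Environment Y R O) (p : Policy Y R O) : IsProbabilityMeasure (law ν p) := by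
  unfold law
  infer_instance

end Histories

/-! ### Comparing the laws of different policies -/

section Comparison

variable {Y : Type*} {R : Finset ℝ} {O : Type*}

/-- The policy `p` takes the actions of the history `h`. -/
def Policy.Follows (p : Policy Y R O) (h : History Y R O) : Prop :=
  ∀ (i : ℕ) (hi : i < h.length), p (h.take i) = h[i].action

theorem follows_concat {p : Policy Y R O} {g : History Y R O} {z : Cycle Y R O} :
    p.Follows (g ++ [z]) ↔ p.Follows g ∧ p g = z.action := by
  constructor
  · intro H
    refine ⟨fun i hi => ?_, ?_⟩
    · have := H i (by simp; omega)
      rwa [List.take_append_of_le_length hi.le, List.getElem_append_left hi] at this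
    · have := H g.length (by simp)
      simpa using this
  · rintro ⟨H, H'⟩ i hi
    rw [List.length_append, List.length_singleton] at hi
    rcases Nat.lt_succ_iff_lt_or_eq.1 hi with hi | hi
    · rw [List.take_append_of_le_length hi.le, List.getElem_append_left hi]
      exact H i hi
    · subst hi
      simp [H']

theorem replace_follows (p : Policy Y R O) (h : History Y R O) : (p.replace h).Follows h := by
  intro i hi
  simp [Policy.replace, min_eq_left hi.le, hi]

theorem replace_apply_of_le (p : Policy Y R O) {h g : History Y R O} (hl : h.length ≤ g.length) :
    p.replace h g = p g := by
  simp [Policy.replace, not_lt.2 hl]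

theorem historyProb_nil (ν : Environment Y R O) : ν.historyProb [] = 1 := by
  simp [Environment.historyProb]

theorem historyProb_concat (ν : Environment Y R O) (g : History Y R O) (z : Cycle Y R O) :
    ν.historyProb (g ++ [z]) = ν.historyProb g * ν g z.action z.percept := by
  have hl : (g ++ [z]).length = g.length + 1 := by simp
  -- The length becomes a variable `n`, so that it can be rewritten to `g.length + 1` without
  -- disturbing the index proofs.
  have key : ∀ (l : History Y R O) (n : ℕ) (hn : l.length = n), ν.historyProb l =
      ∏ i : Fin n, ν (l.take i) (l[i.1]'(by have := i.2; omega)).action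
        (l[i.1]'(by have := i.2; omega)).percept := by
    rintro l n rfl
    rfl
  rw [key _ _ hl, key g _ rfl, Fin.prod_univ_castSucc]
  congr 1
  · refine Finset.prod_congr rfl fun i _ => ?_
    simp [List.take_append_of_le_length i.2.le]
  · simp

theorem cycleLaw_singleton (ν : Environment Y R O) (p : Policy Y R O) (g : History Y R O)
    (z : Cycle Y R O) [Decidable (p g = z.action)] :
    cycleLaw ν p g {z} = if p g = z.action then ν g z.action z.percept else 0 := by
  rw [cycleLaw, PMF.toMeasure_apply_singleton _ _ (MeasurableSet.singleton _)]
  split_ifs with h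
  · rw [h, PMF.map_apply, tsum_eq_single z.percept]
    · simp
    · intro x hx
      rw [if_neg]
      exact fun e => hx (congrArg Cycle.percept e).symm
  · rw [PMF.apply_eq_zero_iff, PMF.mem_support_map_iff]
    rintro ⟨x, -, rfl⟩
    exact h rfl

variable [Finite Y] [Finite O]

open Classical in
-- The policy enters only through whether it follows `g`. Hence two policies that both follow `g`
-- give its cylinder the same mass, which underlies all comparisons below.
theorem law_cylinder (ν : Environment Y R O) (p : Policy Y R O) (g : History Y R O) :
    law ν p (cylinder g) = if p.Follows g then ν.historyProb g else 0 := by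
  induction g using List.reverseRecOn with
  | nil =>
    rw [cylinder_nil, measure_univ, historyProb_nil, if_pos]
    intro i hi
    simp at hi
  | append_singleton g z ih =>
    rw [law_cylinder_concat, ih, historyProb_concat, cycleLaw_singleton, follows_concat]
    by_cases h₁ : p.Follows g <;> by_cases h₂ : p g = z.action <;> simp [h₁, h₂]

theorem law_cylinder_of_follows (ν : Environment Y R O) {p : Policy Y R O} {g : History Y R O}
    (h : p.Follows g) : law ν p (cylinder g) = ν.historyProb g := by
  classical
  rw [law_cylinder, if_pos h]

theorem law_cylinder_of_not_follows (ν : Environment Y R O) {p : Policy Y R O}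
    {g : History Y R O} (h : ¬ p.Follows g) : law ν p (cylinder g) = 0 := by
  classical
  rw [law_cylinder, if_neg h]

/-- The law of a policy is at most the law of another one on every union of cylinders whose
histories can be generated by the latter when they can be generated by the former. -/
theorem law_biUnion_cylinder_le (ν : Environment Y R O) {p q : Policy Y R O}
    {G : Set (History Y R O)} (H : ∀ g ∈ G, p.Follows g → q.Follows g) :
    law ν p (⋃ g ∈ G, cylinder g) ≤ law ν q (⋃ g ∈ G, cylinder g) := by
  -- Keeping only the histories of `G` that are minimal for the prefix order makes the cylinders
  -- disjoint without changing their union, so the two laws can be compared term by term.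
  have hmin : (⋃ g ∈ G, cylinder g) =
      ⋃ g ∈ {g ∈ G | ∀ g' ∈ G, g' <+: g → g' = g}, cylinder g := by
    apply Set.Subset.antisymm
    · intro ω hω
      have hex : ∃ n, firstCycles ω n ∈ G := by
        simp only [Set.mem_iUnion] at hω
        obtain ⟨g, hg, hω⟩ := hω
        exact ⟨g.length, by rwa [mem_cylinder.1 hω]⟩
      classical
      refine Set.mem_biUnion (x := firstCycles ω (Nat.find hex)) ⟨Nat.find_spec hex, ?_⟩
        (mem_cylinder_firstCycles _ _)
      intro g' hg' hpre
      have hle := hpre.length_le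
      rw [length_firstCycles] at hle
      have h1 : g' = firstCycles ω g'.length := by
        rw [← take_firstCycles ω hle]
        exact List.prefix_iff_eq_take.1 hpre
      have h2 := Nat.find_min' hex (h1 ▸ hg')
      rw [h1, le_antisymm hle h2]
    · exact Set.biUnion_subset_biUnion_left fun g hg => hg.1
  have hdisj : Set.PairwiseDisjoint {g ∈ G | ∀ g' ∈ G, g' <+: g → g' = g} cylinder := by
    intro g hg g' hg' hne
    refine Set.disjoint_left.2 fun ω h₁ h₂ => hne ?_
    rcases le_total g.length g'.length with hl | hl
    · exact hg'.2 g hg.1 (isPrefix_of_mem_cylinder h₂ h₁ hl)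
    · exact (hg.2 g' hg'.1 (isPrefix_of_mem_cylinder h₁ h₂ hl)).symm
  rw [hmin, measure_biUnion (Set.to_countable _) hdisj fun g _ => measurableSet_cylinder g,
    measure_biUnion (Set.to_countable _) hdisj fun g _ => measurableSet_cylinder g]
  refine ENNReal.tsum_le_tsum fun g => ?_
  by_cases hp : p.Follows g
  · rw [law_cylinder_of_follows ν hp, law_cylinder_of_follows ν (H g g.2.1 hp)]
  · rw [law_cylinder_of_not_follows ν hp]
    exact zero_le

theorem isProbabilityMeasure_condLaw {ν : Environment Y R O} {h : History Y R O}
    (p : Policy Y R O) (hh : 0 < ν.historyProb h) : IsProbabilityMeasure (condLaw ν p h) := by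
  refine cond_isProbabilityMeasure ?_
  change law ν _ (cylinder h) ≠ 0
  rw [law_cylinder_of_follows ν (replace_follows p h)]
  exact hh.ne'

theorem law_replace_inter_cylinder (ν : Environment Y R O) (q : Policy Y R O)
    (h : History Y R O) (A : Set (ℕ → Cycle Y R O)) :
    law ν (q.replace h) (cylinder h ∩ A) = ν.historyProb h * condLaw ν q h A := by
  have := cond_mul_eq_inter (measurableSet_cylinder h) A (law ν (q.replace h))
  rw [law_cylinder_of_follows ν (replace_follows q h)] at this
  rw [← this, mul_comm]
  rfl

/-- If after each history of a prefix-free set `H` the policy `p` acts as some policy `q h`,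
as long as an event of conditional probability at most `δ` has not occurred, then the
probability that one of these events occurs is at most `δ`. -/
theorem law_biUnion_le_of_condLaw_le (ν : Environment Y R O) (p : Policy Y R O)
    {H : Set (History Y R O)} (hH : ∀ h ∈ H, ∀ h' ∈ H, h <+: h' → h = h')
    (q : History Y R O → Policy Y R O) (G : History Y R O → Set (History Y R O))
    (hpre : ∀ h ∈ H, ∀ g ∈ G h, h <+: g)
    (hagree : ∀ h ∈ H, ∀ g ∈ G h, ∀ i, h.length ≤ i → i < g.length →
      p (g.take i) = q h (g.take i))
    {δ : ENNReal}
    (hδ : ∀ h ∈ H, 0 < ν.historyProb h → condLaw ν (q h) h (⋃ g ∈ G h, cylinder g) ≤ δ) :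
    law ν p (⋃ h ∈ H, ⋃ g ∈ G h, cylinder g) ≤ δ := by
  have hbound : ∀ h ∈ H, law ν p (⋃ g ∈ G h, cylinder g) ≤ law ν p (cylinder h) * δ := by
    intro h hh
    have hsub : (⋃ g ∈ G h, cylinder g) ⊆ cylinder h :=
      Set.iUnion₂_subset fun g hg => cylinder_anti (hpre h hh g hg)
    by_cases hp : p.Follows h
    · rcases eq_or_ne (ν.historyProb h) 0 with h0 | h0
      · have : law ν p (cylinder h) = 0 := by rw [law_cylinder_of_follows ν hp, h0]
        rw [measure_mono_null hsub this]
        exact zero_le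
      · calc law ν p (⋃ g ∈ G h, cylinder g)
            ≤ law ν ((q h).replace h) (⋃ g ∈ G h, cylinder g) := by
              -- Up to the length of `h` the replaced policy repeats the actions of `h`, a prefix of
              -- `g`; afterwards it is `q h`, which agrees with `p`.
              refine law_biUnion_cylinder_le ν fun g hg hpg i hi => ?_
              rcases lt_or_ge i h.length with hih | hih
              · have e := List.prefix_iff_eq_take.1 (hpre h hh g hg)
                have := replace_follows (q h) h i hih
                have e1 : h.take i = g.take i := by
                  conv_lhs => rw [e]
                  rw [List.take_take, min_eq_left hih.le]
                have e2 : h[i] = g[i] := (hpre h hh g hg).getElem hih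
                rwa [e1, e2] at this
              · rw [replace_apply_of_le _ (by simp; omega), ← hagree h hh g hg i hih hi]
                exact hpg i hi
          _ = ν.historyProb h * condLaw ν (q h) h (⋃ g ∈ G h, cylinder g) := by
              rw [← law_replace_inter_cylinder, Set.inter_eq_right.2 hsub]
          _ ≤ law ν p (cylinder h) * δ := by
              rw [law_cylinder_of_follows ν hp]
              gcongr
              exact hδ h hh (pos_iff_ne_zero.2 h0)
    · rw [measure_mono_null hsub (law_cylinder_of_not_follows ν hp)]
      exact zero_le
  have hdisj : H.PairwiseDisjoint cylinder := by
    intro g hg g' hg' hne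
    refine Set.disjoint_left.2 fun ω h₁ h₂ => hne ?_
    rcases le_total g.length g'.length with hl | hl
    · exact hH g hg g' hg' (isPrefix_of_mem_cylinder h₂ h₁ hl)
    · exact (hH g' hg' g hg (isPrefix_of_mem_cylinder h₁ h₂ hl)).symm
  calc law ν p (⋃ h ∈ H, ⋃ g ∈ G h, cylinder g)
      ≤ ∑' h : H, law ν p (⋃ g ∈ G h, cylinder g) :=
        measure_biUnion_le _ (Set.to_countable _) _
    _ ≤ ∑' h : H, law ν p (cylinder h.1) * δ := ENNReal.tsum_le_tsum fun h => hbound h h.2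
    _ = law ν p (⋃ h ∈ H, cylinder h) * δ := by
        rw [ENNReal.tsum_mul_right, measure_biUnion (Set.to_countable _) hdisj
          fun g _ => measurableSet_cylinder g]
    _ ≤ 1 * δ := by gcongr; exact prob_le_one
    _ = δ := one_mul δ

end Comparison

/-! ### Reward sums and bounds on average rewards -/

section Rewards

variable {Y : Type*} {R : Finset ℝ} {O : Type*}

/-- The total reward of a finite history. -/
noncomputable def rewardSum (g : History Y R O) : ℝ := (g.map Cycle.rewardValue).sum

theorem rewardSum_concat (g : History Y R O) (z : Cycle Y R O) :
    rewardSum (g ++ [z]) = rewardSum g + z.rewardValue := by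
  simp [rewardSum]

theorem rewardSum_firstCycles (ω : ℕ → Cycle Y R O) (n : ℕ) :
    rewardSum (firstCycles ω n) = ∑ i ∈ Finset.range n, (ω i).rewardValue := by
  induction n with
  | zero => simp [firstCycles_zero, rewardSum]
  | succ n ih => rw [firstCycles_succ, rewardSum_concat, ih, Finset.sum_range_succ]

theorem averageReward_eq (ω : ℕ → Cycle Y R O) (n : ℕ) :
    averageReward ω n = rewardSum (firstCycles ω n) / n := by
  rw [averageReward, rewardSum_firstCycles]

theorem rewardValue_nonneg {rmax : ℝ} (hR : ∀ r ∈ R, r ∈ Set.Icc 0 rmax)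
    (z : Cycle Y R O) : 0 ≤ z.rewardValue :=
  (hR _ z.percept.reward.2).1

theorem rewardValue_le {rmax : ℝ} (hR : ∀ r ∈ R, r ∈ Set.Icc 0 rmax)
    (z : Cycle Y R O) : z.rewardValue ≤ rmax :=
  (hR _ z.percept.reward.2).2

theorem averageReward_nonneg {rmax : ℝ} (hR : ∀ r ∈ R, r ∈ Set.Icc 0 rmax)
    (ω : ℕ → Cycle Y R O) (n : ℕ) : 0 ≤ averageReward ω n :=
  div_nonneg (Finset.sum_nonneg fun _ _ => rewardValue_nonneg hR _) n.cast_nonneg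

theorem averageReward_le {rmax : ℝ} (hR : ∀ r ∈ R, r ∈ Set.Icc 0 rmax)
    (ω : ℕ → Cycle Y R O) (n : ℕ) : averageReward ω n ≤ rmax := by
  have h0 : 0 ≤ rmax := (rewardValue_nonneg hR (ω 0)).trans (rewardValue_le hR (ω 0))
  refine div_le_of_le_mul₀ n.cast_nonneg h0 ?_
  calc ∑ i ∈ Finset.range n, (ω i).rewardValue
      ≤ ∑ i ∈ Finset.range n, rmax := Finset.sum_le_sum fun i _ => rewardValue_le hR _
    _ = rmax * n := by simp [mul_comm]

theorem upperAverage_nonneg {rmax : ℝ} (hR : ∀ r ∈ R, r ∈ Set.Icc 0 rmax)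
    (ω : ℕ → Cycle Y R O) : 0 ≤ upperAverage ω :=
  le_limsup_of_frequently_le (Eventually.of_forall fun n => averageReward_nonneg hR ω n).frequently
    (isBoundedUnder_of ⟨rmax, averageReward_le hR ω⟩)

theorem le_upperAverage {rmax : ℝ} (hR : ∀ r ∈ R, r ∈ Set.Icc 0 rmax)
    (ω : ℕ → Cycle Y R O) {w : ℝ}
    (h : ∀ ε > 0, ∃ᶠ n in atTop, w - ε ≤ averageReward ω n) : w ≤ upperAverage ω := by
  refine le_of_forall_pos_sub_le fun ε hε => ?_
  exact le_limsup_of_frequently_le (h ε hε) (isBoundedUnder_of ⟨rmax, averageReward_le hR ω⟩)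

theorem le_lowerAverage {rmax : ℝ} (hR : ∀ r ∈ R, r ∈ Set.Icc 0 rmax)
    (ω : ℕ → Cycle Y R O) {w : ℝ}
    (h : ∀ ε > 0, ∀ᶠ n in atTop, w - ε ≤ averageReward ω n) : w ≤ lowerAverage ω := by
  refine le_of_forall_pos_sub_le fun ε hε => ?_
  exact le_liminf_of_le
    (isBoundedUnder_of ⟨rmax, averageReward_le hR ω⟩).isCoboundedUnder_ge (h ε hε)

end Rewards

/-! ### Automata driven by histories -/

section HistoryState

variable {Y : Type*} {R : Finset ℝ} {O : Type*} {S : Type*}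

/-- The state reached after a history by an automaton whose transitions read the whole history. -/
noncomputable def historyState (init : S) (step : S → History Y R O → S) : History Y R O → S :=
  List.reverseRec init fun l z s => step s (l ++ [z])

theorem historyState_nil (init : S) (step : S → History Y R O → S) :
    historyState init step [] = init := by
  simp [historyState]

theorem historyState_concat (init : S) (step : S → History Y R O → S) (g : History Y R O)
    (z : Cycle Y R O) :
    historyState init step (g ++ [z]) = step (historyState init step g) (g ++ [z]) := by
  simp [historyState]

end HistoryState

/-! ### Upper averages: phases with deadlines -/

section UpperExplorable

variable {Y : Type*} {R : Finset ℝ} {O : Type*}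

/-- In state `(a, h)`, the `a`-th phase began after the history `h`; it lasts until time `T a h`. -/
noncomputable def deadlineState (T : ℕ → History Y R O → ℕ) :
    History Y R O → ℕ × History Y R O :=
  historyState (0, []) fun s g => if T s.1 s.2 ≤ g.length then (s.1 + 1, g) else s

theorem deadlineState_concat (T : ℕ → History Y R O → ℕ) (g : History Y R O) (z : Cycle Y R O) :
    deadlineState T (g ++ [z]) =
      if T (deadlineState T g).1 (deadlineState T g).2 ≤ (g ++ [z]).length
      then ((deadlineState T g).1 + 1, g ++ [z]) else deadlineState T g := by
  rw [deadlineState, historyState_concat]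

theorem deadlineState_append_of_lt {T : ℕ → History Y R O → ℕ} {a : ℕ} {h : History Y R O}
    (hs : deadlineState T h = (a, h)) (t : History Y R O) (ht : (h ++ t).length < T a h) :
    deadlineState T (h ++ t) = (a, h) := by
  induction t using List.reverseRecOn with
  | nil => simpa using hs
  | append_singleton t z ih =>
    rw [← List.append_assoc] at ht ⊢
    rw [deadlineState_concat, ih (by rw [List.length_append] at ht; omega), if_neg (not_le.2 ht)]

/-- The phase number never decreases, so phase `a` begins at most once along a sequence. This makes
the set of histories at which it begins prefix-free. -/
theorem deadlineState_append {T : ℕ → History Y R O → ℕ} {a : ℕ} {h : History Y R O}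
    (hs : deadlineState T h = (a, h)) (t : History Y R O) :
    deadlineState T (h ++ t) = (a, h) ∨ a < (deadlineState T (h ++ t)).1 := by
  induction t using List.reverseRecOn with
  | nil => left; simpa using hs
  | append_singleton t z ih =>
    rw [← List.append_assoc, deadlineState_concat]
    split_ifs
    · right
      rcases ih with ih | ih
      · simp [ih]
      · exact ih.trans (Nat.lt_succ_self _)
    · exact ih

theorem exists_deadlineState_eq {T : ℕ → History Y R O → ℕ} (hT : ∀ a h, h.length < T a h)
    (ω : ℕ → Cycle Y R O) (a : ℕ) :
    ∃ n, a ≤ n ∧ deadlineState T (firstCycles ω n) = (a, firstCycles ω n) := by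
  induction a with
  | zero => exact ⟨0, le_rfl, by rw [firstCycles_zero, deadlineState, historyState_nil]⟩
  | succ a ih =>
    obtain ⟨n, hn, hs⟩ := ih
    have hlt := hT a (firstCycles ω n)
    obtain ⟨m, hm⟩ : ∃ m, T a (firstCycles ω n) = m + 1 := ⟨_, (Nat.succ_pred (by omega)).symm⟩
    rw [length_firstCycles] at hlt
    obtain ⟨t, ht⟩ := firstCycles_isPrefix ω (show n ≤ m by omega)
    have hst := deadlineState_append_of_lt hs t (by rw [ht, length_firstCycles]; omega)
    rw [ht] at hst
    refine ⟨m + 1, by omega, ?_⟩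
    rw [firstCycles_succ, deadlineState_concat, hst, if_pos]
    simp [hm]

theorem measurable_averageReward (n : ℕ) :
    Measurable fun ω : ℕ → Cycle Y R O => averageReward ω n := by
  unfold averageReward
  have : ∀ i, Measurable fun ω : ℕ → Cycle Y R O => (ω i).rewardValue := fun i =>
    (measurable_from_top (f := Cycle.rewardValue)).comp (measurable_pi_apply i)
  fun_prop

/-- As `T` grows the events decrease to one on which the upper average is at most `w - ε`, a null
event; continuity from above gives `T`. -/
theorem exists_deadline {P : Measure (ℕ → Cycle Y R O)} [IsFiniteMeasure P] {rmax : ℝ}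
    (hR : ∀ r ∈ R, r ∈ Set.Icc 0 rmax) {w : ℝ}
    (hP : ∀ᵐ ω ∂P, w ≤ upperAverage ω) (k : ℕ) {ε : ℝ} (hε : 0 < ε) {δ : ENNReal} (hδ : 0 < δ) :
    ∃ T, k < T ∧ P {ω | ∀ m, k < m → m ≤ T → averageReward ω m ≤ w - ε} ≤ δ := by
  let A : ℕ → Set (ℕ → Cycle Y R O) :=
    fun T => {ω | ∀ m, k < m → m ≤ T → averageReward ω m ≤ w - ε}
  have hA : Antitone A := fun T T' hT ω hω m h1 h2 => hω m h1 (h2.trans hT)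
  have hm : ∀ T, MeasurableSet (A T) := by
    intro T
    have : A T = ⋂ m, ⋂ (_ : k < m), ⋂ (_ : m ≤ T), {ω | averageReward ω m ≤ w - ε} := by
      ext ω; simp [A]
    rw [this]
    exact MeasurableSet.iInter fun m => MeasurableSet.iInter fun _ => MeasurableSet.iInter fun _ =>
      measurableSet_le (measurable_averageReward m) measurable_const
  have h0 : P (⋂ T, A T) = 0 := by
    refine measure_mono_null ?_ (ae_iff.1 hP)
    intro ω hω
    simp only [Set.mem_iInter] at hω
    change ¬ _
    rw [not_le]
    have : upperAverage ω ≤ w - ε := by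
      refine limsup_le_of_le
        (isBoundedUnder_of ⟨0, averageReward_nonneg hR ω⟩).isCoboundedUnder_le ?_
      filter_upwards [eventually_gt_atTop k] with m hm
      exact hω m m hm le_rfl
    linarith
  have ht := tendsto_measure_iInter_atTop (μ := P) (fun T => (hm T).nullMeasurableSet) hA
    ⟨0, measure_ne_top _ _⟩
  rw [h0] at ht
  obtain ⟨T, hT, hT'⟩ := ((ht.eventually (gt_mem_nhds hδ)).and (eventually_gt_atTop k)).exists
  exact ⟨T, hT', hT.le⟩

variable [Finite Y] [Finite O]

/-- The infimum is over a set bounded below by `0`: every upper optimal value is the upper average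
of some actual sequence. -/
theorem Environment.worstCaseUpperValue_le {ν : Environment Y R O} {rmax : ℝ}
    (hR : ∀ r ∈ R, r ∈ Set.Icc 0 rmax) {h : History Y R O} (hh : 0 < ν.historyProb h) {v : ℝ}
    (hv : ν.IsUpperOptimalValue h v) : ν.worstCaseUpperValue ≤ v := by
  refine csInf_le ⟨0, ?_⟩ ⟨h, hh, hv⟩
  rintro v ⟨h, hh, ⟨q, hq⟩, -⟩
  have := isProbabilityMeasure_condLaw q hh
  obtain ⟨ω, hω⟩ := hq.exists
  rw [← hω]
  exact upperAverage_nonneg hR ω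

theorem exists_policy_worstCaseUpperValue_le [Nonempty Y] {rmax : ℝ}
    (hR : ∀ r ∈ R, r ∈ Set.Icc 0 rmax) (f : ℕ → Environment Y R O)
    (hf : ∀ j, (f j).StronglyUpperExplorable) :
    ∃ p : Policy Y R O, ∀ j, ∀ᵐ ω ∂(law (f j) p), (f j).worstCaseUpperValue ≤ upperAverage ω := by
  have hex : ∀ (a : ℕ) (h : History Y R O), ∃ (q : Policy Y R O) (T : ℕ), h.length < T ∧
      (0 < (f a.unpair.1).historyProb h → condLaw (f a.unpair.1) q h
        {ω | ∀ m, h.length < m → m ≤ T →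
          averageReward ω m ≤ (f a.unpair.1).worstCaseUpperValue - 1 / ((a : ℝ) + 1)} ≤
        (2⁻¹ : ENNReal) ^ a) := by
    intro a h
    by_cases hh : 0 < (f a.unpair.1).historyProb h
    · obtain ⟨v, hv⟩ := hf a.unpair.1 h hh
      obtain ⟨q, hq⟩ := hv.1
      have := isProbabilityMeasure_condLaw q hh
      have hle := Environment.worstCaseUpperValue_le hR hh hv
      have hq' : ∀ᵐ ω ∂(condLaw (f a.unpair.1) q h),
          (f a.unpair.1).worstCaseUpperValue ≤ upperAverage ω := by
        filter_upwards [hq] with ω hω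
        rwa [hω]
      obtain ⟨T, hT, hT'⟩ := exists_deadline hR hq' h.length (ε := 1 / ((a : ℝ) + 1))
        (by positivity) (δ := (2⁻¹ : ENNReal) ^ a) (ENNReal.pow_pos (by simp) a)
      exact ⟨q, T, hT, fun _ => hT'⟩
    · exact ⟨fun _ => Classical.arbitrary Y, h.length + 1, by omega, fun h' => absurd h' hh⟩
  choose q T hT hprob using hex
  refine ⟨fun g => q (deadlineState T g).1 (deadlineState T g).2 g, fun j => ?_⟩
  set p : Policy Y R O := fun g => q (deadlineState T g).1 (deadlineState T g).2 g with hp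
  -- `H a` holds the starting points of phase `a` when it serves `j`; `G a h` holds the histories at
  -- the deadline for which the phase has missed its goal throughout.
  let H : ℕ → Set (History Y R O) := fun a => {h | a.unpair.1 = j ∧ deadlineState T h = (a, h)}
  let G : ℕ → History Y R O → Set (History Y R O) := fun a h =>
    {g | h <+: g ∧ g.length = T a h ∧ ∀ m, h.length < m → m ≤ T a h →
      rewardSum (g.take m) / m ≤ (f a.unpair.1).worstCaseUpperValue - 1 / ((a : ℝ) + 1)}
  have hbad : ∀ a, law (f j) p (⋃ h ∈ H a, ⋃ g ∈ G a h, cylinder g) ≤ (2⁻¹ : ENNReal) ^ a := by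
    intro a
    refine law_biUnion_le_of_condLaw_le (f j) p ?_ (q a) (G a) ?_ ?_ ?_
    · rintro h ⟨-, hh⟩ h' ⟨-, hh'⟩ ⟨t, rfl⟩
      rcases deadlineState_append hh t with e | e
      · rw [e] at hh'
        exact congrArg Prod.snd hh'
      · rw [hh'] at e
        exact absurd e (lt_irrefl _)
    · exact fun h _ g hg => hg.1
    · rintro h ⟨-, hh⟩ g ⟨⟨t, rfl⟩, hl, -⟩ i h1 h2
      have e : (h ++ t).take i = h ++ t.take (i - h.length) := by
        rw [List.take_append, List.take_of_length_le h1]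
      have := deadlineState_append_of_lt hh (t.take (i - h.length)) (by
        rw [← e, ← hl, List.length_take]; omega)
      rw [← e] at this
      simp only [hp, this]
    · rintro h ⟨rfl, hh⟩ h0
      refine (measure_mono ?_).trans (hprob a h h0)
      refine Set.iUnion₂_subset fun g hg ω hω m h1 h2 => ?_
      have := hg.2.2 m h1 h2
      rw [averageReward_eq]
      rwa [← mem_cylinder.1 hω, take_firstCycles ω (by rw [hg.2.1]; exact h2)] at this
  have hsum : ∑' a, law (f j) p (⋃ h ∈ H a, ⋃ g ∈ G a h, cylinder g) ≠ ⊤ := by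
    refine ne_top_of_le_ne_top ?_ (ENNReal.tsum_le_tsum hbad)
    rw [ENNReal.tsum_geometric]
    simp
  filter_upwards [ae_eventually_notMem hsum] with ω hω
  refine le_upperAverage hR ω fun ε hε => ?_
  rw [frequently_atTop]
  intro n₀
  obtain ⟨a₀, ha₀⟩ := eventually_atTop.1 hω
  obtain ⟨b, hb⟩ := exists_nat_one_div_lt hε
  let c := max (max a₀ n₀) b
  -- Phase `a` serves `j`, and `a ≥ c` puts it beyond the last failure and beyond `n₀`, with `1 / (a
  -- + 1) < ε`.
  let a := Nat.pair j c
  have hca : c ≤ a := Nat.right_le_pair j c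
  obtain ⟨n, han, hn⟩ := exists_deadlineState_eq hT ω a
  have hnot := ha₀ a (((le_max_left _ _).trans (le_max_left _ _)).trans hca)
  have haj : a.unpair.1 = j := by simp [a]
  have hlt := hT a (firstCycles ω n)
  rw [length_firstCycles] at hlt
  by_contra hcon
  push Not at hcon
  refine hnot (Set.mem_biUnion (x := firstCycles ω n) ⟨haj, hn⟩
    (Set.mem_biUnion (x := firstCycles ω (T a (firstCycles ω n))) ⟨?_, by simp, ?_⟩
      (mem_cylinder_firstCycles _ _)))
  · exact firstCycles_isPrefix ω hlt.le
  · intro m h1 h2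
    rw [length_firstCycles] at h1
    rw [take_firstCycles ω h2, ← averageReward_eq, haj]
    have hn₀ : n₀ ≤ c := (le_max_right _ _).trans (le_max_left _ _)
    refine (hcon m (by omega)).le.trans ?_
    have hba : (b : ℝ) ≤ a := by exact_mod_cast (le_max_right _ _).trans hca
    have : 1 / ((a : ℝ) + 1) ≤ 1 / ((b : ℝ) + 1) := by gcongr
    linarith

end UpperExplorable

/-! ### Lower averages: stages of trials and rejections -/

section Trials

/-- The data that govern the trials of a sequence of environments: their target values, reference
rewards and admissible deficits, and, for every stage, the tolerance and the delay of the tests and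
the time at which the stage begins. -/
structure TrialSchedule where
  value : ℕ → ℝ
  ref : ℕ → ℕ → ℝ
  slack : ℕ → ℕ → ℝ → ℝ
  tol : ℕ → ℝ
  delay : ℕ → ℕ
  start : ℕ → ℕ

/-- The state of the trials: the current stage, the history after which the current trial began,
and the environments that were rejected in the current stage. -/
structure TrialState (Y : Type*) (R : Finset ℝ) (O : Type*) where
  stage : ℕ
  origin : History Y R O
  rejected : Finset ℕ

open Classical in
/-- The environment on trial: one of largest value among those not rejected. -/
noncomputable def TrialSchedule.candidate (σ : TrialSchedule) (s : ℕ) (J : Finset ℕ) : ℕ :=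
  if h : (Finset.range (s + 1) \ J).Nonempty then
    (Finset.exists_max_image (Finset.range (s + 1) \ J) σ.value h).choose
  else 0

theorem TrialSchedule.candidate_le (σ : TrialSchedule) (s : ℕ) (J : Finset ℕ) :
    σ.candidate s J ≤ s := by
  unfold TrialSchedule.candidate
  split_ifs with h
  · have := (Finset.exists_max_image (Finset.range (s + 1) \ J) σ.value h).choose_spec.1
    rw [Finset.mem_sdiff, Finset.mem_range] at this
    omega
  · exact Nat.zero_le s

theorem TrialSchedule.candidate_spec (σ : TrialSchedule) {s j : ℕ} {J : Finset ℕ} (hj : j ≤ s)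
    (hJ : j ∉ J) : σ.candidate s J ∉ J ∧ σ.value j ≤ σ.value (σ.candidate s J) := by
  have hmem : j ∈ Finset.range (s + 1) \ J := by simp [hJ]; omega
  have h : (Finset.range (s + 1) \ J).Nonempty := ⟨j, hmem⟩
  have hs := (Finset.exists_max_image (Finset.range (s + 1) \ J) σ.value h).choose_spec
  unfold TrialSchedule.candidate
  rw [dif_pos h]
  exact ⟨(Finset.mem_sdiff.1 hs.1).2, hs.2 j hmem⟩

variable {Y : Type*} {R : Finset ℝ} {O : Type*}

/-- Environment `i`, on trial since the history `h`, fails the test of stage `s` after `g`. -/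
def TrialSchedule.Fails (σ : TrialSchedule) (s i : ℕ) (h g : History Y R O) : Prop :=
  ∃ n ≥ σ.delay s, g.length = h.length + n + 1 ∧
    σ.slack i (h.length + 1) (σ.tol s) + n * σ.tol s <
      ∑ t ∈ Finset.Icc h.length (h.length + n), σ.ref i t - (rewardSum g - rewardSum h)

open Classical in
/-- The transition of the trials when the history becomes `g`. -/
noncomputable def TrialSchedule.step (σ : TrialSchedule) (x : TrialState Y R O)
    (g : History Y R O) : TrialState Y R O :=
  if σ.start (x.stage + 1) ≤ g.length then ⟨x.stage + 1, g, ∅⟩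
  else if σ.Fails x.stage (σ.candidate x.stage x.rejected) x.origin g then
    ⟨x.stage, g, insert (σ.candidate x.stage x.rejected) x.rejected⟩
  else x

/-- The state of the trials after a history. -/
noncomputable def TrialSchedule.state (σ : TrialSchedule) :
    History Y R O → TrialState Y R O :=
  historyState ⟨0, [], ∅⟩ σ.step

/-- The policy that acts as the policy `Q i h` while environment `i` is on trial since `h`. -/
noncomputable def TrialSchedule.policy (σ : TrialSchedule)
    (Q : ℕ → History Y R O → Policy Y R O) : Policy Y R O :=
  fun g => Q (σ.candidate (σ.state g).stage (σ.state g).rejected) (σ.state g).origin g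

theorem TrialSchedule.state_nil (σ : TrialSchedule) :
    σ.state ([] : History Y R O) = ⟨0, [], ∅⟩ :=
  historyState_nil _ _

theorem TrialSchedule.state_concat (σ : TrialSchedule) (g : History Y R O) (z : Cycle Y R O) :
    σ.state (g ++ [z]) = σ.step (σ.state g) (g ++ [z]) :=
  historyState_concat _ _ _ _

theorem TrialSchedule.state_firstCycles_succ (σ : TrialSchedule) (ω : ℕ → Cycle Y R O) (n : ℕ) :
    σ.state (firstCycles ω (n + 1)) =
      σ.step (σ.state (firstCycles ω n)) (firstCycles ω (n + 1)) := by
  rw [firstCycles_succ, σ.state_concat]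

theorem TrialSchedule.step_cases (σ : TrialSchedule) (x : TrialState Y R O)
    (g : History Y R O) :
    (σ.start (x.stage + 1) ≤ g.length ∧ σ.step x g = ⟨x.stage + 1, g, ∅⟩) ∨
    (g.length < σ.start (x.stage + 1) ∧
      σ.Fails x.stage (σ.candidate x.stage x.rejected) x.origin g ∧
      σ.step x g = ⟨x.stage, g, insert (σ.candidate x.stage x.rejected) x.rejected⟩) ∨
    (g.length < σ.start (x.stage + 1) ∧
      ¬ σ.Fails x.stage (σ.candidate x.stage x.rejected) x.origin g ∧ σ.step x g = x) := by
  unfold TrialSchedule.step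
  split_ifs with h₁ h₂
  · exact Or.inl ⟨h₁, rfl⟩
  · exact Or.inr (Or.inl ⟨not_le.1 h₁, h₂, rfl⟩)
  · exact Or.inr (Or.inr ⟨not_le.1 h₁, h₂, rfl⟩)

/-- Within a stage a trial ends only by rejection, and rejections last until the stage ends. Hence
no environment goes on trial twice in a stage while unrejected. -/
theorem TrialSchedule.state_append (σ : TrialSchedule) {h : History Y R O}
    (t : History Y R O) :
    σ.state (h ++ t) = σ.state h ∨ (σ.state h).stage < (σ.state (h ++ t)).stage ∨
      ((σ.state (h ++ t)).stage = (σ.state h).stage ∧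
        σ.candidate (σ.state h).stage (σ.state h).rejected ∈ (σ.state (h ++ t)).rejected) := by
  induction t using List.reverseRecOn with
  | nil => left; simp
  | append_singleton t z ih =>
    rw [← List.append_assoc, σ.state_concat]
    rcases σ.step_cases (σ.state (h ++ t)) (h ++ t ++ [z]) with
      ⟨-, e⟩ | ⟨-, -, e⟩ | ⟨-, -, e⟩
    · rw [e]
      right; left
      rcases ih with ih | ih | ih
      · simp [ih]
      · exact ih.trans (Nat.lt_succ_self _)
      · simp [ih.1]
    · rw [e]
      right
      rcases ih with ih | ih | ih
      · right; simp [ih]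
      · left; exact ih
      · right; exact ⟨ih.1, Finset.mem_insert_of_mem ih.2⟩
    · rw [e]
      exact ih

/-- The histories after which a trial of environment `j` begins in stage `s`. -/
def TrialSchedule.origins (σ : TrialSchedule) (s j : ℕ) : Set (History Y R O) :=
  -- Requiring `j` to be unrejected excludes the default candidate `0` once every environment has
  -- been rejected.
  {h | (σ.state h).origin = h ∧ (σ.state h).stage = s ∧ j ∉ (σ.state h).rejected ∧
    σ.candidate s (σ.state h).rejected = j}

/-- The histories after which the trial of environment `j` that began after `h` ends with a
rejection. -/
def TrialSchedule.rejections (σ : TrialSchedule) (s j : ℕ) (h : History Y R O) :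
    Set (History Y R O) :=
  {g | h <+: g ∧ σ.Fails s j h g ∧
    ∀ i, h.length ≤ i → i < g.length → σ.state (g.take i) = σ.state h}

/-- The event that environment `j` is rejected in stage `s`. -/
def TrialSchedule.rejectionEvent (σ : TrialSchedule) (s j : ℕ) : Set (ℕ → Cycle Y R O) :=
  ⋃ h ∈ σ.origins s j, ⋃ g ∈ σ.rejections s j h, cylinder g

/-- By `TrialSchedule.state_append` the origins of the trials of `j` in stage `s` are prefix-free,
and during such a trial the policy is `Q j h`. So the bound for one trial holds for the whole stage.
-/
theorem TrialSchedule.law_rejectionEvent_le [Finite Y] [Finite O] (σ : TrialSchedule)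
    (Q : ℕ → History Y R O → Policy Y R O) (ν : Environment Y R O) {s j : ℕ} {δ : ENNReal}
    (hδ : j ≤ s → ∀ h, 0 < ν.historyProb h →
      condLaw ν (Q j h) h {ω | ∃ n, ω ∈ cylinder h ∧ σ.Fails s j h (firstCycles ω n)} ≤ δ) :
    law ν (σ.policy Q) (σ.rejectionEvent s j) ≤ δ := by
  refine law_biUnion_le_of_condLaw_le ν _ ?_ (Q j) (σ.rejections s j) ?_ ?_ ?_
  · rintro h ⟨ho, hs, hj, hc⟩ h' ⟨ho', hs', hj', hc'⟩ ⟨t, rfl⟩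
    rcases σ.state_append (h := h) t with e | e | e
    · rw [e] at ho'
      exact ho.symm.trans ho'
    · omega
    · rw [hs, hc] at e
      exact absurd e.2 hj'
  · exact fun h _ g hg => hg.1
  · rintro h ⟨ho, hs, hj, hc⟩ g ⟨-, -, hg⟩ i h1 h2
    simp only [TrialSchedule.policy, hg i h1 h2, hs, hc, ho]
  · rintro h ⟨ho, hs, hj, hc⟩ h0
    refine (measure_mono ?_).trans (hδ (hc ▸ σ.candidate_le _ _) h h0)
    refine Set.iUnion₂_subset fun g hg ω hω => ⟨g.length, cylinder_anti hg.1 hω, ?_⟩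
    rw [mem_cylinder.1 hω]
    exact hg.2.1

/-- What the state `x` of the trials along `ω` at time `n` satisfies. -/
structure TrialSchedule.StateInvariant (σ : TrialSchedule) (ω : ℕ → Cycle Y R O) (n : ℕ)
    (x : TrialState Y R O) : Prop where
  start_le : σ.start x.stage ≤ x.origin.length
  length_le : x.origin.length ≤ n
  lt_start : n < σ.start (x.stage + 1)
  mem_cylinder : ω ∈ cylinder x.origin
  subset : x.rejected ⊆ Finset.range (x.stage + 1)
  passes : x.origin.length = n ∨
    ¬ σ.Fails x.stage (σ.candidate x.stage x.rejected) x.origin (firstCycles ω n)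
  state_eq : ∀ i, x.origin.length ≤ i → i ≤ n → σ.state (firstCycles ω i) = x

theorem TrialSchedule.stateInvariant (σ : TrialSchedule) (h0 : σ.start 0 = 0)
    (hmono : StrictMono σ.start) (ω : ℕ → Cycle Y R O) (n : ℕ) :
    σ.StateInvariant ω n (σ.state (firstCycles ω n)) := by
  induction n with
  | zero =>
    rw [firstCycles_zero, σ.state_nil]
    refine ⟨by simp [h0], by simp, ?_, by simp [cylinder_nil], by simp, Or.inl rfl, ?_⟩
    · have := hmono (Nat.lt_succ_self 0)
      simpa [h0] using this
    · intro i _ hi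
      obtain rfl : i = 0 := by omega
      rw [firstCycles_zero, σ.state_nil]
  | succ n ih =>
    have hnew : ∀ x : TrialState Y R O, x.origin = firstCycles ω (n + 1) →
        σ.state (firstCycles ω (n + 1)) = x →
        σ.start x.stage ≤ n + 1 → n + 1 < σ.start (x.stage + 1) →
        x.rejected ⊆ Finset.range (x.stage + 1) → σ.StateInvariant ω (n + 1) x := by
      intro x ho hx h1 h2 h3
      have hl : x.origin.length = n + 1 := by simp [ho]
      refine ⟨by omega, hl.le, h2, by rw [ho]; exact mem_cylinder_firstCycles _ _, h3,
        Or.inl hl, fun i hi hi' => ?_⟩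
      obtain rfl : i = n + 1 := by omega
      exact hx
    have hst := σ.state_firstCycles_succ ω n
    rcases σ.step_cases (σ.state (firstCycles ω n)) (firstCycles ω (n + 1)) with
      ⟨hl, e⟩ | ⟨hl, -, e⟩ | ⟨hl, hf, e⟩
    · rw [length_firstCycles] at hl
      refine hnew _ (by rw [hst, e]) rfl (by rw [hst, e]; exact hl) ?_ (by simp [hst, e])
      rw [hst, e]
      -- The new stage begins exactly at its starting time, and strict monotonicity keeps the next
      -- one ahead, so no stage is skipped.
      have := hmono (Nat.lt_succ_self ((σ.state (firstCycles ω n)).stage + 1))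
      have := ih.lt_start
      simp only [Nat.succ_eq_add_one] at *
      omega
    · rw [length_firstCycles] at hl
      refine hnew _ (by rw [hst, e]) rfl ?_ (by rw [hst, e]; exact hl) ?_
      · rw [hst, e]
        have := ih.start_le
        have := ih.length_le
        change σ.start (σ.state (firstCycles ω n)).stage ≤ n + 1
        omega
      · rw [hst, e]
        refine Finset.insert_subset ?_ ih.subset
        have := σ.candidate_le (σ.state (firstCycles ω n)).stage
          (σ.state (firstCycles ω n)).rejected
        simp only [Finset.mem_range]
        omega
    · rw [length_firstCycles] at hl
      have hs := hst.trans e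
      rw [hs]
      refine ⟨ih.start_le, ih.length_le.trans (Nat.le_succ n), hl, ih.mem_cylinder, ih.subset,
        Or.inr hf, fun i hi hi' => ?_⟩
      rcases Nat.lt_succ_iff_lt_or_eq.1 (Nat.lt_succ_of_le hi') with h | rfl
      · exact ih.state_eq i hi (by omega)
      · exact hs

theorem TrialSchedule.StateInvariant.firstCycles_length {σ : TrialSchedule}
    {ω : ℕ → Cycle Y R O} {n : ℕ} {x : TrialState Y R O} (hx : σ.StateInvariant ω n x) :
    firstCycles ω x.origin.length = x.origin :=
  Reactive.mem_cylinder.1 hx.mem_cylinder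

theorem TrialSchedule.stage_eq (σ : TrialSchedule) (h0 : σ.start 0 = 0)
    (hmono : StrictMono σ.start) (ω : ℕ → Cycle Y R O) {s n : ℕ} (h1 : σ.start s ≤ n)
    (h2 : n < σ.start (s + 1)) : (σ.state (firstCycles ω n)).stage = s := by
  have hx := σ.stateInvariant h0 hmono ω n
  have a := hmono.lt_iff_lt.1 (h1.trans_lt hx.lt_start)
  have b := hmono.lt_iff_lt.1 ((hx.start_le.trans hx.length_le).trans_lt h2)
  omega

/-- When `j` is first rejected in the stage, the trial just ended began at an origin of `j` and kept
its state up to then, so `ω` lies in the rejection event. -/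
theorem TrialSchedule.notMem_rejected (σ : TrialSchedule) (h0 : σ.start 0 = 0)
    (hmono : StrictMono σ.start) {ω : ℕ → Cycle Y R O} {s j : ℕ}
    (hω : ω ∉ σ.rejectionEvent s j) (n : ℕ) (hs : (σ.state (firstCycles ω n)).stage = s) :
    j ∉ (σ.state (firstCycles ω n)).rejected := by
  induction n with
  | zero => simp [firstCycles_zero, σ.state_nil]
  | succ n ih =>
    have hx := σ.stateInvariant h0 hmono ω n
    have hst := σ.state_firstCycles_succ ω n
    rcases σ.step_cases (σ.state (firstCycles ω n)) (firstCycles ω (n + 1)) with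
      ⟨hl, e⟩ | ⟨hl, hf, e⟩ | ⟨hl, hf, e⟩
    · rw [hst, e]
      simp
    · rw [hst, e] at hs ⊢
      have hs' : (σ.state (firstCycles ω n)).stage = s := hs
      have ih := ih hs'
      simp only [Finset.mem_insert, not_or]
      refine ⟨fun hj => hω ?_, ih⟩
      rw [← hj, hs'] at hf
      have hso : σ.state (σ.state (firstCycles ω n)).origin = σ.state (firstCycles ω n) := by
        have := hx.state_eq _ le_rfl hx.length_le
        rwa [hx.firstCycles_length] at this
      refine Set.mem_biUnion (x := (σ.state (firstCycles ω n)).origin) ?_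
        (Set.mem_biUnion (x := firstCycles ω (n + 1)) ⟨?_, hf, ?_⟩ (mem_cylinder_firstCycles _ _))
      · refine ⟨by rw [hso], by rw [hso, hs'], by rwa [hso], by rw [hso, ← hs', ← hj]⟩
      · conv_lhs => rw [← hx.firstCycles_length]
        exact firstCycles_isPrefix ω (hx.length_le.trans (Nat.le_succ n))
      · intro i h1 h2
        rw [length_firstCycles] at h2
        rw [take_firstCycles ω h2.le, hso]
        exact hx.state_eq i h1 (by omega)
    · rw [hst, e] at hs ⊢
      exact ih hs

/-- The conditions under which stage `s` begins late enough for its errors to be negligible. -/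
structure TrialSchedule.LateStage (σ : TrialSchedule) (rmax : ℝ) (s : ℕ) (η : ℝ) : Prop where
  ref_sum : ∀ i ≤ s, ∀ k ≥ σ.start s, |∑ t ∈ Finset.range k, σ.ref i t - σ.value i * k| ≤ η * k
  slack_le : ∀ i ≤ s, ∀ k ≥ σ.start s, σ.slack i (k + 1) (σ.tol s) ≤ η * k
  delay_le : σ.delay s * rmax ≤ η * σ.start s
  value_le : ∀ i ≤ s, σ.value i ≤ η * σ.start s

/-- The shortfall of the first `n` rewards from the average value `w`. -/
noncomputable def deficit (w : ℝ) (ω : ℕ → Cycle Y R O) (n : ℕ) : ℝ :=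
  w * n - rewardSum (firstCycles ω n)

theorem deficit_succ_le {rmax : ℝ} (hR : ∀ r ∈ R, r ∈ Set.Icc 0 rmax) (w : ℝ)
    (ω : ℕ → Cycle Y R O) (n : ℕ) : deficit w ω (n + 1) ≤ deficit w ω n + w := by
  have := rewardValue_nonneg hR (ω n)
  unfold deficit
  rw [firstCycles_succ, rewardSum_concat]
  push_cast
  linarith

theorem rewardSum_firstCycles_mono {rmax : ℝ} (hR : ∀ r ∈ R, r ∈ Set.Icc 0 rmax)
    (ω : ℕ → Cycle Y R O) : Monotone fun n => rewardSum (firstCycles ω n) := by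
  refine monotone_nat_of_le_succ fun n => ?_
  have := rewardValue_nonneg hR (ω n)
  rw [firstCycles_succ, rewardSum_concat]
  linarith

/-- The candidate `i` has value at least that of `j`, so it suffices to compare rewards with `value
i`. Replacing `value i` by the reference rewards costs `η * n` at each end of the trial; the passed
test, or the delay, costs one more `η * n` and the tolerance. -/
theorem TrialSchedule.deficit_le_deficit_origin (σ : TrialSchedule) {rmax : ℝ}
    (hR : ∀ r ∈ R, r ∈ Set.Icc 0 rmax) (hρ : ∀ i t, σ.ref i t ∈ Set.Icc 0 rmax) {η : ℝ}
    (hη : 0 ≤ η) {ω : ℕ → Cycle Y R O} {n j : ℕ} {x : TrialState Y R O}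
    (hx : σ.StateInvariant ω n x) (hε : 0 ≤ σ.tol x.stage) (hl : σ.LateStage rmax x.stage η)
    (hj : j ≤ x.stage) (hjx : j ∉ x.rejected) :
    deficit (σ.value j) ω n ≤ deficit (σ.value j) ω x.origin.length + 3 * η * n +
      σ.tol x.stage * (n - x.origin.length) := by
  have hτn := hx.length_le
  have hsτ := hx.start_le
  have hfc := hx.firstCycles_length
  have hpass := hx.passes
  have hmono := rewardSum_firstCycles_mono hR ω hτn
  obtain ⟨-, hval⟩ := σ.candidate_spec hj hjx
  have hcs := σ.candidate_le x.stage x.rejected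
  set i := σ.candidate x.stage x.rejected with hi
  set τ := x.origin.length with hτ
  have hτn' : (τ : ℝ) ≤ n := by exact_mod_cast hτn
  have hsτ' : (σ.start x.stage : ℝ) ≤ τ := by exact_mod_cast hsτ
  have hητ : η * τ ≤ η * n := by gcongr
  have hηs : η * σ.start x.stage ≤ η * τ := by gcongr
  have hn1 := abs_le.1 (hl.ref_sum i hcs n (hsτ.trans hτn))
  have hτ1 := abs_le.1 (hl.ref_sum i hcs τ hsτ)
  have hIco := Finset.sum_range_add_sum_Ico (σ.ref i) hτn
  have hprod : 0 ≤ (σ.value i - σ.value j) * ((n : ℝ) - τ) :=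
    mul_nonneg (by linarith) (by linarith)
  have htol : 0 ≤ σ.tol x.stage * ((n : ℝ) - τ) := mul_nonneg hε (by linarith)
  have key : ∑ t ∈ Finset.Ico τ n, σ.ref i t -
      (rewardSum (firstCycles ω n) - rewardSum (firstCycles ω τ)) ≤
      η * n + σ.tol x.stage * (n - τ) := by
    rcases hpass with h | h
    · rw [h]
      simp only [Finset.Ico_self, Finset.sum_empty]
      have : 0 ≤ η * (n : ℝ) := by positivity
      linarith
    · rcases Nat.eq_or_lt_of_le hτn with h' | h'
      · rw [h']
        simp only [Finset.Ico_self, Finset.sum_empty]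
        have : 0 ≤ η * (n : ℝ) := by positivity
        rw [h'] at htol
        linarith
      -- Test index `k` refers to `k + 1` cycles of the trial. Before the delay no test applies, but
      -- the whole reference sum is at most `delay * rmax`, which is negligible.
      obtain ⟨k, rfl⟩ : ∃ k, n = τ + k + 1 := ⟨n - τ - 1, by omega⟩
      rcases lt_or_ge k (σ.delay x.stage) with hk | hk
      · have h1 : ∑ t ∈ Finset.Ico τ (τ + k + 1), σ.ref i t ≤ σ.delay x.stage * rmax := by
          have hr0 : 0 ≤ rmax := (hρ i 0).1.trans (hρ i 0).2
          calc ∑ t ∈ Finset.Ico τ (τ + k + 1), σ.ref i t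
              ≤ ∑ t ∈ Finset.Ico τ (τ + k + 1), rmax :=
                Finset.sum_le_sum fun t _ => (hρ i t).2
            _ = ((k + 1 : ℕ) : ℝ) * rmax := by
                rw [Finset.sum_const, Nat.card_Ico, nsmul_eq_mul]
                congr 2
                omega
            _ ≤ σ.delay x.stage * rmax := by
                gcongr
                omega
        have := hl.delay_le
        have hm : rewardSum (firstCycles ω τ) ≤ rewardSum (firstCycles ω (τ + k + 1)) := hmono
        linarith
      · have h1 : ¬ (σ.slack i (τ + 1) (σ.tol x.stage) + k * σ.tol x.stage <
            ∑ t ∈ Finset.Icc τ (τ + k), σ.ref i t -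
              (rewardSum (firstCycles ω (τ + k + 1)) - rewardSum x.origin)) := fun hlt =>
          h ⟨k, hk, by rw [length_firstCycles], hlt⟩
        rw [not_lt] at h1
        have h2 := hl.slack_le i hcs τ hsτ
        have h3 : Finset.Ico τ (τ + k + 1) = Finset.Icc τ (τ + k) := by
          ext t
          simp only [Finset.mem_Ico, Finset.mem_Icc]
          omega
        rw [h3, hfc]
        push_cast at *
        nlinarith
  unfold deficit
  nlinarith

/-- Each rejection costs `3 * η` times the elapsed time for the trial up to its last passed test,
and at most `η` times it for the one cycle in which the test fails. -/
theorem TrialSchedule.deficit_origin_le (σ : TrialSchedule) {rmax : ℝ}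
    (hR : ∀ r ∈ R, r ∈ Set.Icc 0 rmax) (hρ : ∀ i t, σ.ref i t ∈ Set.Icc 0 rmax)
    (h0 : σ.start 0 = 0) (hmono : StrictMono σ.start) {η : ℝ} (hη : 0 ≤ η)
    {ω : ℕ → Cycle Y R O} {s j : ℕ} (hε : 0 ≤ σ.tol s) (hl : σ.LateStage rmax s η) (hj : j ≤ s)
    (hω : ω ∉ σ.rejectionEvent s j) (n : ℕ) (hs : (σ.state (firstCycles ω n)).stage = s) :
    deficit (σ.value j) ω (σ.state (firstCycles ω n)).origin.length ≤
      deficit (σ.value j) ω (σ.start s) +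
      (σ.state (firstCycles ω n)).rejected.card *
        (4 * η * (σ.state (firstCycles ω n)).origin.length) +
      σ.tol s * ((σ.state (firstCycles ω n)).origin.length - σ.start s) := by
  induction n with
  | zero =>
    rw [firstCycles_zero, σ.state_nil] at *
    obtain rfl : 0 = s := hs
    simp [h0]
  | succ n ih =>
    have hx := σ.stateInvariant h0 hmono ω n
    have hst := σ.state_firstCycles_succ ω n
    rcases σ.step_cases (σ.state (firstCycles ω n)) (firstCycles ω (n + 1)) with
      ⟨hlen, e⟩ | ⟨-, -, e⟩ | ⟨-, -, e⟩
    · rw [hst, e] at hs ⊢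
      rw [length_firstCycles] at hlen
      have hs' : (σ.state (firstCycles ω n)).stage + 1 = s := hs
      have hlt := hx.lt_start
      rw [hs'] at hlt hlen
      have : n + 1 = σ.start s := by omega
      simp [this]
    · rw [hst, e] at hs ⊢
      have hs' : (σ.state (firstCycles ω n)).stage = s := hs
      have ih := ih hs'
      have hnot := σ.notMem_rejected h0 hmono hω n hs'
      have hb := σ.deficit_le_deficit_origin hR hρ hη hx (by rwa [hs']) (by rwa [hs'])
        (by rwa [hs']) hnot
      have hcand := (σ.candidate_spec (hs' ▸ hj) hnot).1
      have hd := deficit_succ_le hR (σ.value j) ω n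
      have hv := hl.value_le j hj
      have h1 : (σ.start s : ℝ) ≤ n := by
        have := hx.start_le.trans hx.length_le
        rw [hs'] at this
        exact_mod_cast this
      have h2 : ((σ.state (firstCycles ω n)).origin.length : ℝ) ≤ n := by
        exact_mod_cast hx.length_le
      simp only [length_firstCycles, Finset.card_insert_of_notMem hcand]
      rw [hs'] at hb
      have h3 : η * σ.start s ≤ η * n := by gcongr
      have h4 : ((σ.state (firstCycles ω n)).rejected.card : ℝ) *
          (4 * η * (σ.state (firstCycles ω n)).origin.length) ≤
          (σ.state (firstCycles ω n)).rejected.card * (4 * η * (n + 1)) :=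
        mul_le_mul_of_nonneg_left
          (mul_le_mul_of_nonneg_left (by linarith) (by linarith)) (Nat.cast_nonneg _)
      push_cast
      linarith
    · rw [hst, e] at hs ⊢
      exact ih hs

theorem TrialSchedule.deficit_le (σ : TrialSchedule) {rmax : ℝ}
    (hR : ∀ r ∈ R, r ∈ Set.Icc 0 rmax) (hρ : ∀ i t, σ.ref i t ∈ Set.Icc 0 rmax)
    (h0 : σ.start 0 = 0) (hmono : StrictMono σ.start)
    {ω : ℕ → Cycle Y R O} {s j : ℕ} (hε : 0 ≤ σ.tol s)
    (hl : σ.LateStage rmax s (σ.tol s / (4 * (s + 1)))) (hj : j ≤ s)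
    (hω : ω ∉ σ.rejectionEvent s j) {m : ℕ} (h1 : σ.start s ≤ m) (h2 : m ≤ σ.start (s + 1)) :
    deficit (σ.value j) ω m ≤ deficit (σ.value j) ω (σ.start s) + 3 * σ.tol s * m := by
  have hs0 : (0 : ℝ) < 4 * (s + 1) := by positivity
  set η := σ.tol s / (4 * (s + 1)) with hηdef
  have hη : 0 ≤ η := by positivity
  have hηs : 4 * η * (s + 1) = σ.tol s := by
    rw [hηdef]
    field_simp
  have hmain : ∀ n, σ.start s ≤ n → n < σ.start (s + 1) →
      deficit (σ.value j) ω n ≤ deficit (σ.value j) ω (σ.start s) + 2 * σ.tol s * n := by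
    intro n h1 h2
    have hs := σ.stage_eq h0 hmono ω h1 h2
    have hx := σ.stateInvariant h0 hmono ω n
    have hnot := σ.notMem_rejected h0 hmono hω n hs
    have ha := σ.deficit_origin_le hR hρ h0 hmono hη hε hl hj hω n hs
    have hb := σ.deficit_le_deficit_origin hR hρ hη hx (by rwa [hs]) (by rwa [hs])
      (by rwa [hs]) hnot
    rw [hs] at hb
    -- `j` itself is not rejected, which leaves at most `s` rejections. Their `4 * η` each and the
    -- `3 * η` of the current trial stay within `4 * η * (s + 1) = tol s`.
    have hcard : (σ.state (firstCycles ω n)).rejected.card ≤ s := by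
      have hsub : (σ.state (firstCycles ω n)).rejected ⊆ (Finset.range (s + 1)).erase j := by
        intro i hi
        refine Finset.mem_erase.2 ⟨?_, hs ▸ hx.subset hi⟩
        rintro rfl
        exact hnot hi
      refine (Finset.card_le_card hsub).trans ?_
      rw [Finset.card_erase_of_mem (by simp; omega)]
      simp
    have hcard' : ((σ.state (firstCycles ω n)).rejected.card : ℝ) ≤ s := by exact_mod_cast hcard
    have h3 : ((σ.state (firstCycles ω n)).origin.length : ℝ) ≤ n := by
      exact_mod_cast hx.length_le
    have h4 : ((σ.state (firstCycles ω n)).rejected.card : ℝ) *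
        (4 * η * (σ.state (firstCycles ω n)).origin.length) ≤ s * (4 * η * n) := by
      gcongr
    have h5 : 0 ≤ σ.tol s * σ.start s := by positivity
    have h6 : 0 ≤ η * n := by positivity
    have h7 : (s : ℝ) * (4 * η * n) + 4 * η * n = σ.tol s * n := by
      rw [← hηs]
      ring
    linarith
  rcases h2.lt_or_eq with h2 | rfl
  · have := hmain m h1 h2
    have : 0 ≤ σ.tol s * m := by positivity
    linarith
  -- At the end of the stage the state already belongs to the next one; the bound one cycle earlier
  -- is used, and the extra cycle fits in the third `tol s`.
  · have hlt := hmono (Nat.lt_succ_self s)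
    rw [Nat.succ_eq_add_one] at hlt
    obtain ⟨n, hn⟩ : ∃ n, σ.start (s + 1) = n + 1 := ⟨_, (Nat.succ_pred (by omega)).symm⟩
    have hd := deficit_succ_le hR (σ.value j) ω n
    have := hmain n (by omega) (by omega)
    have hv := hl.value_le j hj
    rw [hn]
    have h3 : (σ.start s : ℝ) ≤ n := by
      have : σ.start s ≤ n := by omega
      exact_mod_cast this
    have h4 : η * σ.start s ≤ η * n := by gcongr
    have h5 : 4 * η * n ≤ 4 * η * n * (s + 1) :=
      le_mul_of_one_le_right (by positivity) (by linarith [(s.cast_nonneg : (0 : ℝ) ≤ s)])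
    have h6 : 4 * η * n * (s + 1) = σ.tol s * n := by
      rw [← hηs]
      ring
    have h7 : 0 ≤ η * n := by positivity
    push_cast
    linarith

/-- If the stages double in length and their tolerances vanish, an environment that is rejected in
finitely many stages only is outperformed. -/
theorem TrialSchedule.value_le_lowerAverage (σ : TrialSchedule) {rmax : ℝ}
    (hR : ∀ r ∈ R, r ∈ Set.Icc 0 rmax) (hρ : ∀ i t, σ.ref i t ∈ Set.Icc 0 rmax)
    (h0 : σ.start 0 = 0) (hmono : StrictMono σ.start)
    (hdouble : ∀ s, 2 * σ.start s ≤ σ.start (s + 1))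
    (hε : ∀ s, 0 ≤ σ.tol s) (hε0 : Tendsto σ.tol atTop (𝓝 0))
    (hl : ∀ s ≥ 1, σ.LateStage rmax s (σ.tol s / (4 * (s + 1)))) {j : ℕ}
    {ω : ℕ → Cycle Y R O} (hω : ∀ᶠ s in atTop, ω ∉ σ.rejectionEvent s j) :
    σ.value j ≤ lowerAverage ω := by
  refine le_lowerAverage hR ω fun δ hδ => ?_
  obtain ⟨S, hS⟩ := eventually_atTop.1 ((hω.and (hε0.eventually
    (gt_mem_nhds (show 0 < δ / 12 by positivity)))).and
      ((eventually_ge_atTop j).and (eventually_ge_atTop 1)))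
  set C := |deficit (σ.value j) ω (σ.start S)| with hC
  have hstage : ∀ s ≥ S, ∀ m, σ.start s ≤ m → m ≤ σ.start (s + 1) →
      deficit (σ.value j) ω m ≤ deficit (σ.value j) ω (σ.start s) + δ / 4 * m := by
    intro s hs m h1 h2
    obtain ⟨⟨ha, hb⟩, hc, hd⟩ := hS s hs
    have h3 := σ.deficit_le hR hρ h0 hmono (hε s) (hl s hd) hc ha h1 h2
    have h4 : 3 * σ.tol s * m ≤ δ / 4 * m := by
      gcongr
      linarith
    linarith
  -- Doubling reproduces the bound: `δ / 2 * start s ≤ δ / 4 * start (s + 1)`, and stage `s` adds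
  -- another `δ / 4 * start (s + 1)`.
  have hstart : ∀ s ≥ S, deficit (σ.value j) ω (σ.start s) ≤ C + δ / 2 * σ.start s := by
    intro s hs
    induction s, hs using Nat.le_induction with
    | base =>
      have := le_abs_self (deficit (σ.value j) ω (σ.start S))
      have : 0 ≤ δ / 2 * σ.start S := by positivity
      linarith
    | succ s hs ih =>
      have h1 := hstage s hs (σ.start (s + 1)) (hmono (Nat.lt_succ_self s)).le le_rfl
      have h2 : (2 : ℝ) * σ.start s ≤ σ.start (s + 1) := by exact_mod_cast hdouble s
      nlinarith
  obtain ⟨M, hM⟩ := exists_nat_gt (C / (δ / 4))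
  filter_upwards [eventually_ge_atTop (σ.start S), eventually_ge_atTop M,
    eventually_gt_atTop 0] with m hm hMm hm0
  have hm0' : (0 : ℝ) < m := by exact_mod_cast hm0
  obtain ⟨s, hs, h1, h2⟩ : ∃ s ≥ S, σ.start s ≤ m ∧ m ≤ σ.start (s + 1) := by
    have hx := σ.stateInvariant h0 hmono ω m
    refine ⟨(σ.state (firstCycles ω m)).stage, ?_, hx.start_le.trans hx.length_le,
      hx.lt_start.le⟩
    have := hmono.lt_iff_lt.1 (hm.trans_lt hx.lt_start)
    omega
  have h3 := hstage s hs m h1 h2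
  have h4 := hstart s hs
  have h5 : δ / 2 * σ.start s ≤ δ / 2 * m := by gcongr
  have h6 : C ≤ δ / 4 * m := by
    rw [div_lt_iff₀ (by positivity)] at hM
    have : (M : ℝ) ≤ m := by exact_mod_cast hMm
    nlinarith
  rw [averageReward_eq, le_div_iff₀ hm0']
  unfold deficit at h3 h4
  linarith

end Trials

/-! ### Value-stable environments: choice of the delays and stages -/

section ValueStable

variable {Y : Type*} {R : Finset ℝ} {O : Type*}

theorem sum_Icc_rewardValue (ω : ℕ → Cycle Y R O) (k n : ℕ) :
    ∑ i ∈ Finset.Icc k (k + n), (ω i).rewardValue =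
      rewardSum (firstCycles ω (k + n + 1)) - rewardSum (firstCycles ω k) := by
  have h : Finset.Icc k (k + n) = Finset.Ico k (k + n + 1) := by
    ext t
    simp only [Finset.mem_Ico, Finset.mem_Icc]
    omega
  rw [h, rewardSum_firstCycles, rewardSum_firstCycles,
    Finset.sum_Ico_eq_sub (fun i => (ω i).rewardValue) (by omega : k ≤ k + n + 1)]

variable [Finite Y] [Finite O]

/-- Summable bounds on the probabilities of large deficits bound uniformly in the history the
probability that a large deficit ever occurs after a long delay. -/
theorem eventually_condLaw_le {ν : Environment Y R O} {Q : History Y R O → Policy Y R O}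
    {A : History Y R O → ℕ → Set (ℕ → Cycle Y R O)} {φ : ℕ → ℝ} (hφ : Summable φ)
    (hA : ∀ h, 0 < ν.historyProb h → ∀ n ≥ 1, (condLaw ν (Q h) h).real (A h n) ≤ φ n)
    {δ : ENNReal} (hδ : 0 < δ) :
    ∀ᶠ N in atTop, ∀ h, 0 < ν.historyProb h →
      condLaw ν (Q h) h (⋃ n ≥ N, A h n) ≤ δ := by
  have ht : Tendsto (fun N => ENNReal.ofReal (∑' n, φ (n + N))) atTop (𝓝 0) := by
    have := ENNReal.tendsto_ofReal (tendsto_sum_nat_add φ)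
    rwa [ENNReal.ofReal_zero] at this
  filter_upwards [ht.eventually (gt_mem_nhds hδ), eventually_ge_atTop 1] with N hN hN1 h hh
  have := isProbabilityMeasure_condLaw (Q h) hh
  have hsub : (⋃ n ≥ N, A h n) ⊆ ⋃ n, A h (n + N) := by
    refine Set.iUnion₂_subset fun n hn => ?_
    obtain ⟨m, rfl⟩ := Nat.exists_eq_add_of_le' hn
    exact Set.subset_iUnion (fun m => A h (m + N)) m
  -- `φ` is not assumed nonnegative; from index `1` on it is, because it bounds a probability.
  have hnn : ∀ n, 0 ≤ φ (n + N) := fun n =>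
    measureReal_nonneg.trans (hA h hh (n + N) (by omega))
  calc condLaw ν (Q h) h (⋃ n ≥ N, A h n)
      ≤ condLaw ν (Q h) h (⋃ n, A h (n + N)) := measure_mono hsub
    _ ≤ ∑' n, condLaw ν (Q h) h (A h (n + N)) := measure_iUnion_le _
    _ ≤ ∑' n, ENNReal.ofReal (φ (n + N)) := by
        refine ENNReal.tsum_le_tsum fun n => ?_
        rw [← ofReal_measureReal]
        exact ENNReal.ofReal_le_ofReal (hA h hh (n + N) (by omega))
    _ = ENNReal.ofReal (∑' n, φ (n + N)) :=
        (ENNReal.ofReal_tsum_of_nonneg hnn ((summable_nat_add_iff N).2 hφ)).symm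
    _ ≤ δ := hN.le

theorem exists_policy_worstCaseValue_le [Nonempty Y] {rmax : ℝ}
    (hR : ∀ r ∈ R, r ∈ Set.Icc 0 rmax) (f : ℕ → Environment Y R O)
    (hf : ∀ j, (f j).WorstCaseValueStable rmax) :
    ∃ p : Policy Y R O, ∀ j, ∀ᵐ ω ∂(law (f j) p), (f j).worstCaseValue ≤ lowerAverage ω := by
  choose ρ d φ hρ hlim hd hφ hpol using fun j => (hf j).2
  have hex : ∀ j (h : History Y R O), ∃ p : Policy Y R O, 0 < (f j).historyProb h →
      ∀ ε > 0, ∀ n ≥ 1, (condLaw (f j) p h).real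
          {ω | d j (h.length + 1) ε + n * ε <
            ∑ i ∈ Finset.Icc h.length (h.length + n), ρ j i -
              ∑ i ∈ Finset.Icc h.length (h.length + n), (ω i).rewardValue} ≤ φ j n ε := by
    intro j h
    by_cases hh : 0 < (f j).historyProb h
    · obtain ⟨p, hp⟩ := hpol j h hh
      exact ⟨p, fun _ => hp⟩
    · exact ⟨fun _ => Classical.arbitrary Y, fun h' => absurd h' hh⟩
  choose Q hQ using hex
  let ε : ℕ → ℝ := fun s => 1 / ((s : ℝ) + 1)
  let η : ℕ → ℝ := fun s => ε s / (4 * ((s : ℝ) + 1))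
  have hε : ∀ s, 0 < ε s := fun s => by positivity
  have hη : ∀ s, 0 < η s := fun s => div_pos (hε s) (by positivity)
  let A : ℕ → ℕ → History Y R O → ℕ → Set (ℕ → Cycle Y R O) := fun s j h n =>
    {ω | d j (h.length + 1) (ε s) + n * ε s <
      ∑ i ∈ Finset.Icc h.length (h.length + n), ρ j i -
        ∑ i ∈ Finset.Icc h.length (h.length + n), (ω i).rewardValue}
  have hdelay : ∀ s, ∃ N, ∀ j ≤ s, ∀ h, 0 < (f j).historyProb h →
      condLaw (f j) (Q j h) h (⋃ n ≥ N, A s j h n) ≤ (2⁻¹ : ENNReal) ^ s := by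
    intro s
    have : ∀ᶠ N in atTop, ∀ j ∈ Set.Iic s, ∀ h, 0 < (f j).historyProb h →
        condLaw (f j) (Q j h) h (⋃ n ≥ N, A s j h n) ≤ (2⁻¹ : ENNReal) ^ s :=
      (eventually_all_finite (Set.finite_Iic s)).2 fun j _ =>
        eventually_condLaw_le (hφ j (ε s) (hε s))
          (fun h hh n hn => hQ j h hh (ε s) (hε s) n hn) (ENNReal.pow_pos (by simp) s)
    exact this.exists
  choose N hN using hdelay
  have hlate : ∀ s, ∃ B, ∀ k ≥ B, (∀ i ≤ s,
      |∑ t ∈ Finset.range k, ρ i t - (f i).worstCaseValue * k| ≤ η s * k ∧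
      d i (k + 1) (ε s) ≤ η s * k ∧ (f i).worstCaseValue ≤ η s * k) ∧
      N s * rmax ≤ η s * k := by
    intro s
    have hbig : ∀ c : ℝ, ∀ᶠ k : ℕ in atTop, c ≤ η s * k := fun c =>
      (tendsto_natCast_atTop_atTop.const_mul_atTop (hη s)).eventually_ge_atTop c
    have : ∀ᶠ k : ℕ in atTop, ∀ i ∈ Set.Iic s,
        |∑ t ∈ Finset.range k, ρ i t - (f i).worstCaseValue * k| ≤ η s * k ∧
        d i (k + 1) (ε s) ≤ η s * k ∧ (f i).worstCaseValue ≤ η s * k := by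
      refine (eventually_all_finite (Set.finite_Iic s)).2 fun i _ => ?_
      have h1 : ∀ᶠ k : ℕ in atTop,
          |(∑ t ∈ Finset.range k, ρ i t) / k - (f i).worstCaseValue| < η s :=
        (hlim i).eventually (Metric.ball_mem_nhds _ (hη s))
      -- Half of `η s` is used because the slack is taken at `k + 1`, and `k + 1 ≤ 2 * k`.
      have h2 := (tendsto_add_atTop_nat 1).eventually
        ((hd i (ε s) (hε s)).bound (half_pos (hη s)))
      filter_upwards [h1, h2, hbig (f i).worstCaseValue, eventually_ge_atTop 1]
        with k h1 h2 h3 hk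
      have hk' : (1 : ℝ) ≤ k := by exact_mod_cast hk
      refine ⟨?_, ?_, h3⟩
      · have e : ∑ t ∈ Finset.range k, ρ i t - (f i).worstCaseValue * k =
            ((∑ t ∈ Finset.range k, ρ i t) / k - (f i).worstCaseValue) * k := by
          field_simp
        rw [e, abs_mul, abs_of_nonneg (by linarith : (0 : ℝ) ≤ k)]
        gcongr
      · rw [Real.norm_eq_abs, Real.norm_natCast] at h2
        refine (le_abs_self _).trans (h2.trans ?_)
        push_cast
        nlinarith [hη s]
    obtain ⟨B, hB⟩ := eventually_atTop.1 (this.and (hbig (N s * rmax)))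
    exact ⟨B, hB⟩
  choose B hB using hlate
  -- The recursion makes the starting times strictly increasing, at least doubling, and at least `B
  -- s` for `s ≥ 1`. Stage `0` starts at `0` and need not be late.
  let K : ℕ → ℕ := fun s => Nat.rec 0 (fun s k => 2 * k + B (s + 1) + 1) s
  have hK : ∀ s, K (s + 1) = 2 * K s + B (s + 1) + 1 := fun s => rfl
  let σ : TrialSchedule := ⟨fun j => (f j).worstCaseValue, ρ, d, ε, N, K⟩
  refine ⟨σ.policy Q, fun j => ?_⟩
  have hbad : ∀ s, law (f j) (σ.policy Q) (σ.rejectionEvent s j) ≤ (2⁻¹ : ENNReal) ^ s := by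
    intro s
    refine σ.law_rejectionEvent_le Q (f j) fun hj h hh => (measure_mono ?_).trans (hN s j hj h hh)
    rintro ω ⟨m, hω, n, hn, hl, hlt⟩
    refine Set.mem_biUnion (x := n) hn ?_
    change d j (h.length + 1) (ε s) + n * ε s < _ - _
    rw [sum_Icc_rewardValue, mem_cylinder.1 hω]
    rw [length_firstCycles] at hl
    rwa [hl] at hlt
  have hsum : ∑' s, law (f j) (σ.policy Q) (σ.rejectionEvent s j) ≠ ⊤ := by
    refine ne_top_of_le_ne_top ?_ (ENNReal.tsum_le_tsum hbad)
    rw [ENNReal.tsum_geometric]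
    simp
  filter_upwards [ae_eventually_notMem hsum] with ω hω
  refine σ.value_le_lowerAverage hR hρ rfl (strictMono_nat_of_lt_succ fun s => ?_) (fun s => ?_)
    (fun s => (hε s).le) tendsto_one_div_add_atTop_nhds_zero_nat (fun s hs => ?_) hω
  · change K s < K (s + 1)
    rw [hK]
    omega
  · change 2 * K s ≤ K (s + 1)
    rw [hK]
    omega
  · have hBK : B s ≤ K s := by
      obtain ⟨s, rfl⟩ := Nat.exists_eq_add_of_le' hs
      rw [hK]
      omega
    exact ⟨fun i hi k hk => ((hB s k (hBK.trans hk)).1 i hi).1,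
      fun i hi k hk => ((hB s k (hBK.trans hk)).1 i hi).2.1, (hB s (K s) hBK).2,
      fun i hi => ((hB s (K s) hBK).1 i hi).2.2⟩

end ValueStable

end Reactive

theorem theorem3 {Y O : Type*} [Finite Y] [Nonempty Y] [Finite O] (rmax : ℝ) (R : Finset ℝ)
    (hR : ∀ r ∈ R, r ∈ Set.Icc 0 rmax) :
    (∀ C : Set (Reactive.Environment Y R O), C.Countable →
      (∀ ν ∈ C, ν.WorstCaseValueStable rmax) →
      ∃ p : Reactive.Policy Y R O, ∀ ν ∈ C,
        ∀ᵐ ω ∂(Reactive.law ν p), ν.worstCaseValue ≤ Reactive.lowerAverage ω) ∧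
    (∀ C : Set (Reactive.Environment Y R O), C.Countable →
      (∀ ν ∈ C, ν.StronglyUpperExplorable) →
      ∃ p : Reactive.Policy Y R O, ∀ ν ∈ C,
        ∀ᵐ ω ∂(Reactive.law ν p), ν.worstCaseUpperValue ≤ Reactive.upperAverage ω) := by
  constructor
  · intro C hC hν
    -- An empty class is not the range of a sequence, and any policy serves it.
    rcases C.eq_empty_or_nonempty with rfl | hne
    · exact ⟨fun _ => Classical.arbitrary Y, fun ν h => absurd h (Set.notMem_empty ν)⟩
    obtain ⟨f, rfl⟩ := hC.exists_eq_range hne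
    obtain ⟨p, hp⟩ := Reactive.exists_policy_worstCaseValue_le hR f
      fun j => hν _ (Set.mem_range_self j)
    exact ⟨p, Set.forall_mem_range.2 hp⟩
  · intro C hC hν
    rcases C.eq_empty_or_nonempty with rfl | hne
    · exact ⟨fun _ => Classical.arbitrary Y, fun ν h => absurd h (Set.notMem_empty ν)⟩
    obtain ⟨f, rfl⟩ := hC.exists_eq_range hne
    obtain ⟨p, hp⟩ := Reactive.exists_policy_worstCaseUpperValue_le hR f
      fun j => hν _ (Set.mem_range_self j)
    exact ⟨p, Set.forall_mem_range.2 hp⟩
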